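/- Let $\mathcal N$ be the set of sequences $(k_1,k_2,\ldots)$ of natural numbers (including $0$) with only finitely many non-zero entries. The map $$\mathcal F:\mathcal N\to\mathbb R,\qquad \mathcal F(k_1,k_2,\ldots)=\sum_{\ell=1}^\infty k_\ell\exp\left(\tfrac1\ell\right)$$ is injective. Consequently the following holds. Let $a<b$, let $f:[a,b]\to\mathbb R$ be real-analytic and not identically zero, let $h:\mathbb R\to\mathbb R$ be piecewise continuous (finitely many discontinuities in every bounded interval, finite one-sided limits everywhere) with improper integral $\int_{-\infty}^\infty h(t)\,\mathrm dt=1$, let $\sigma\in[-\infty,\infty]$, and put $\mathrm H(x)=\int_\sigma^x h(t)\,\mathrm dt$, $$g_2=\exp\left(\frac{f'^2-ff''}{f'^2+f^2}\right),\qquad \mathrm I_{g_2}=h\left(\tfrac{f'}{f}\right)g_2\,\frac{f'^2-ff''}{f^2}-\mathrm H\left(\tfrac{f'}{f}\right)g_2'.$$ The multiplicity of a zero $x_0$ of $f$ is $\mu_f(x_0)=\lim_{x\to x_0}\frac{f'(x)^2}{f'(x)^2-f(x)f''(x)}$ (limit within $[a,b]$); for analytic $f$ this is the usual order of vanishing.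 Limits from outside $[a,b]$ are taken along any extension of $f$ to a neighbourhood of $[a,b]$ which is $C^2$ near each endpoint where $f\neq0$, and which is antisymmetric about each endpoint where $f=0$ (that is, near $a$ it is $x\mapsto -f(2a-x)$ for $x<a$, and similarly at $b$). Such extensions exist. For $\ell\ge1$ let $n_\ell$ be the number of zeros of $f$ of multiplicity $\ell$ in $[a,b]$ and $\mathring n_\ell$ the number of those in $(a,b)$. These numbers are finite, and non-zero for only finitely many $\ell$. The integral $\int_a^b\mathrm I_{g_2}(x)\,\mathrm dx$ converges as an improper integral (and it is an ordinary Lebesgue integral if moreover $h(x)=O(1/x^2)$ for $|x|\to\infty$), all the limits below exist, the arguments of $\mathcal F^{-1}$ below lie in the range of $\mathcal F$, and $$\begin{aligned} (n_1,n_2,\ldots)&=\mathcal F^{-1}\left(\int_a^b\mathrm I_{g_2}(x)\,\mathrm dx+\lim_{x\searrow b}\left[\mathrm H\left(\tfrac{f'(x)}{f(x)}\right)g_2(x)\right]-\lim_{x\nearrow a}\left[\mathrm H\left(\tfrac{f'(x)}{f(x)}\right)g_2(x)\right]\right),\\ (\mathring n_1,\mathring n_2,\ldots)&=\mathcal F^{-1}\left(\int_a^b\mathrm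 I_{g_2}(x)\,\mathrm dx+\lim_{x\nearrow b}\left[\mathrm H\left(\tfrac{f'(x)}{f(x)}\right)g_2(x)\right]-\lim_{x\searrow a}\left[\mathrm H\left(\tfrac{f'(x)}{f(x)}\right)g_2(x)\right]\right). \end{aligned}$$ -/

import Mathlib

open Set Filter Topology MeasureTheory

noncomputable section

namespace ZeroCount

/-- The map `(k₁, k₂, …) ↦ ∑ k_ℓ exp (1 / ℓ)` on the sequences of natural numbers, indexed by
`ℓ = 1, 2, …`, with only finitely many non-zero entries. -/
def profileMap (k : ℕ+ →₀ ℕ) : ℝ :=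
  k.sum fun ℓ m => (m : ℝ) * Real.exp (1 / (ℓ : ℝ))

/-- Piecewise continuity on the real line: finitely many discontinuities in every bounded interval,
and finite one-sided limits at every point. -/
def PiecewiseContinuous (h : ℝ → ℝ) : Prop :=
  (∀ r : ℝ, ({x | ¬ ContinuousAt h x} ∩ Icc (-r) r).Finite) ∧
    ∀ x : ℝ, (∃ l, Tendsto h (𝓝[<] x) (𝓝 l)) ∧ ∃ l, Tendsto h (𝓝[>] x) (𝓝 l)

/-- The improper integral of `h` over the whole line converges and equals `v`. -/
def HasImproperIntegralLine (h : ℝ → ℝ) (v : ℝ) : Prop :=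
  (∀ u w : ℝ, IntervalIntegrable h volume u w) ∧
    Tendsto (fun p : ℝ × ℝ => ∫ t in p.1..p.2, h t) (atBot ×ˢ atTop) (𝓝 v)

/-- The improper integral of `φ` over the open interval `(c, d)`, both ends being taken as limits,
converges and equals `v`. -/
def HasImproperIntegralIoo (φ : ℝ → ℝ) (c d v : ℝ) : Prop :=
  c < d ∧ (∀ u w : ℝ, c < u → u ≤ w → w < d → IntervalIntegrable φ volume u w) ∧
    Tendsto (fun p : ℝ × ℝ => ∫ t in p.1..p.2, φ t) (𝓝[>] c ×ˢ 𝓝[<] d) (𝓝 v)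

/-- The improper integral of `φ` over `[a, b]`, with finitely many singular points, converges and
equals `v`: for some partition `a = y 0 < y 1 < ⋯ < y m = b` the improper integrals over the
intervals `(y i, y (i + 1))` converge and add up to `v`. -/
def HasImproperIntegral (φ : ℝ → ℝ) (a b v : ℝ) : Prop :=
  ∃ (m : ℕ) (y w : ℕ → ℝ), y 0 = a ∧ y m = b ∧
    (∀ i < m, HasImproperIntegralIoo φ (y i) (y (i + 1)) (w i)) ∧
    ∑ i ∈ Finset.range m, w i = v

/-- `H x = ∫ t from σ to x, h t`, where `σ ∈ [-∞, ∞]`; the integral is improper if `σ = ±∞`. -/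
def primitive (h : ℝ → ℝ) (σ : EReal) (x : ℝ) : ℝ :=
  if σ = ⊥ then limUnder atBot (fun s : ℝ => ∫ t in s..x, h t)
  else if σ = ⊤ then limUnder atTop (fun s : ℝ => ∫ t in s..x, h t)
  else ∫ t in σ.toReal..x, h t

/-- `g₂ = exp ((f'² - f f'') / (f'² + f²))`. -/
def g₂ (f : ℝ → ℝ) (x : ℝ) : ℝ :=
  Real.exp ((deriv f x ^ 2 - f x * deriv (deriv f) x) / (deriv f x ^ 2 + f x ^ 2))

/-- `I_g = h (f' / f) g (f'² - f f'') / f² - H (f' / f) g'`. -/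
def integrand (h : ℝ → ℝ) (σ : EReal) (f g : ℝ → ℝ) (x : ℝ) : ℝ :=
  h (deriv f x / f x) * g x * ((deriv f x ^ 2 - f x * deriv (deriv f) x) / f x ^ 2)
    - primitive h σ (deriv f x / f x) * deriv g x

/-- `H (f' / f) g`, the function whose one-sided limits are the boundary terms. -/
def boundaryTerm (h : ℝ → ℝ) (σ : EReal) (f g : ℝ → ℝ) (x : ℝ) : ℝ :=
  primitive h σ (deriv f x / f x) * g x

/-- `F` is an extension of `f : [a, b] → ℝ` beyond the end points, as used for the limits from
outside `[a, b]`: it is twice continuously differentiable near an end point that is not a zero, and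
antisymmetric with respect to an end point that is a zero. -/
structure IsEndpointExtension (f F : ℝ → ℝ) (a b : ℝ) : Prop where
  eqOn : EqOn F f (Icc a b)
  left_regular : f a ≠ 0 → ContDiffAt ℝ 2 F a
  left_antisymm : f a = 0 → ∀ᶠ x in 𝓝[<] a, F x = -f (2 * a - x)
  right_regular : f b ≠ 0 → ContDiffAt ℝ 2 F b
  right_antisymm : f b = 0 → ∀ᶠ x in 𝓝[>] b, F x = -f (2 * b - x)

/-- The zero `x₀` of `f : [a, b] → ℝ` has multiplicity
`μ = lim f'² / (f'² - f f'')`, the limit being taken for `x → x₀` in `[a, b] \ {x₀}`. -/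
def HasMultiplicity (f : ℝ → ℝ) (a b x₀ μ : ℝ) : Prop :=
  Tendsto (fun x => deriv f x ^ 2 / (deriv f x ^ 2 - f x * deriv (deriv f) x))
    (𝓝[Icc a b \ {x₀}] x₀) (𝓝 μ)

/-- The zeros of multiplicity `ℓ` of `f : [a, b] → ℝ` in `[a, b]`. -/
def zerosIcc (f : ℝ → ℝ) (a b : ℝ) (ℓ : ℕ+) : Set ℝ :=
  {x | x ∈ Icc a b ∧ f x = 0 ∧ HasMultiplicity f a b x (ℓ : ℝ)}

/-- The zeros of multiplicity `ℓ` of `f : [a, b] → ℝ` in `(a, b)`. -/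
def zerosIoo (f : ℝ → ℝ) (a b : ℝ) (ℓ : ℕ+) : Set ℝ :=
  {x | x ∈ Ioo a b ∧ f x = 0 ∧ HasMultiplicity f a b x (ℓ : ℝ)}

end ZeroCount

end

noncomputable section

namespace ZeroCount

/-! Injectivity comes from the transcendence of e. For the finitely many indices that occur, all
numbers exp(1/ℓ) are powers, with distinct exponents L/ℓ, of the single number exp(1/L). That number
is transcendental because its L-th power is e, so a coincidence of two values would be a vanishing
integer polynomial in it. Transcendence of e is Hermite's argument: good simultaneous approximations
of e, e², … with a common denominator produce a non-zero integer of absolute value below 1.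

For the counting formula, (f'/f)' = -(f'² - f f'')/f², so away from the zeros the integrand is the
derivative of -H(f'/f) g₂ (`hasDerivAt_boundaryTerm`, `integral_integrand`). At a zero of
multiplicity m, f'/f tends to -∞ from the left and to +∞ from the right, while g₂ tends to exp(1/m)
(`exists_multiplicity`). Hence H(f'/f) g₂ jumps by exp(1/m) times ∫ h = 1. Summing over the
intervals between zeros (`hasImproperIntegral_of_finset`) leaves the two inner boundary values and
the jumps at the interior zeros. Replacing inner by outer boundary limits adds the jumps at the
endpoints: the antisymmetric extension makes f'/f behave at an endpoint zero as at an interior one,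
and at a non-zero endpoint there is no jump. The resulting sum of exp(1/m) determines the
multiplicities by injectivity. -/

/-! ### Transcendence of e and injectivity of `profileMap` -/

open Polynomial in
theorem aeval_exp_one_ne_zero_of_coeff_zero_ne_zero {P : ℤ[X]} (h0 : P.coeff 0 ≠ 0) :
    aeval (Complex.exp 1) P ≠ 0 := by
  intro hP
  set d := P.natDegree with hd
  -- The roots are 1, …, d, so the approximations below concern e, …, e^d simultaneously.
  set f : ℤ[X] := ∏ j ∈ Finset.range d, (X - C ((j : ℤ) + 1)) with hf
  have hf0 : f.eval 0 ≠ 0 := by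
    rw [hf, eval_prod, Finset.prod_ne_zero_iff]
    intro j _
    simp only [eval_sub, eval_X, eval_C]
    omega
  have hroot : ∀ j ∈ Finset.range d, ((j : ℂ) + 1) ∈ f.aroots ℂ := by
    intro j hj
    have hne : f ≠ 0 := by
      rintro h; simp [h] at hf0
    rw [mem_aroots]
    refine ⟨hne, ?_⟩
    rw [hf, map_prod]
    exact Finset.prod_eq_zero hj (by simp)
  obtain ⟨c, hc⟩ := LindemannWeierstrass.exp_polynomial_approx f hf0
  set A : ℝ := ∑ j ∈ Finset.range d, |(P.coeff (j + 1) : ℝ)| with hA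
  have hlim : Tendsto (fun p : ℕ => A * (c ^ p / (p - 1).factorial)) atTop (𝓝 0) := by
    rw [← tendsto_add_atTop_iff_nat 1]
    have h1 := (FloorSemiring.tendsto_pow_div_factorial_atTop c).const_mul (A * c)
    rw [mul_zero] at h1
    refine h1.congr fun n => ?_
    simp only [Nat.add_sub_cancel, pow_succ]
    ring
  obtain ⟨N, hN⟩ := (hlim.eventually (gt_mem_nhds (zero_lt_one' ℝ))).exists_forall_of_atTop
  -- The prime exceeds three numbers: N makes the error less than 1, |f(0)| is required by the
  -- approximation, and |P(0)| ensures that p does not divide the constant coefficient.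
  obtain ⟨p, hple, hp⟩ := Nat.exists_infinite_primes
    (N + (eval 0 f).natAbs + (P.coeff 0).natAbs + 1)
  obtain ⟨n, hn, gp, -, hgp⟩ := hc p (by omega) hp
  -- This is n·P(e) with each n·e^(j+1) replaced by its approximation p·gp(j+1). Modulo p only the
  -- constant term survives, so M ≠ 0. Since P(e) = 0, M is also a combination of the approximation
  -- errors, hence small.
  set M : ℤ := P.coeff 0 * n + p * ∑ j ∈ Finset.range d, P.coeff (j + 1) * gp.eval ((j : ℤ) + 1)
    with hM
  have hMdvd : ¬ (p : ℤ) ∣ M := by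
    rw [hM, dvd_add_left (dvd_mul_right _ _)]
    intro hdvd
    rcases Int.Prime.dvd_mul' hp hdvd with h | h
    · have := Nat.le_of_dvd (Int.natAbs_pos.mpr h0) (Int.natCast_dvd.mp h)
      omega
    · exact hn h
  have hMne : M ≠ 0 := by rintro h; exact hMdvd (h ▸ dvd_zero _)
  have hexp : ∑ j ∈ Finset.range d, (P.coeff (j + 1) : ℂ) * Complex.exp ((j : ℂ) + 1)
      = -(P.coeff 0 : ℂ) := by
    rw [aeval_eq_sum_range, Finset.sum_range_succ'] at hP
    simp only [zsmul_eq_mul, pow_zero, mul_one] at hP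
    rw [← eq_neg_iff_add_eq_zero] at hP
    rw [← hP]
    refine Finset.sum_congr rfl fun j _ => ?_
    rw [← Complex.exp_nat_mul]
    push_cast
    simp
  have hMeq : (M : ℂ) = -∑ j ∈ Finset.range d, (P.coeff (j + 1) : ℂ) *
      (n • Complex.exp ((j : ℂ) + 1) - p • aeval ((j : ℂ) + 1) gp) := by
    have h1 : ∀ j : ℕ, aeval ((j : ℂ) + 1) gp = ((gp.eval ((j : ℤ) + 1) : ℤ) : ℂ) := by
      intro j
      have h2 := aeval_algebraMap_apply_eq_algebraMap_eval (A := ℂ) ((j : ℤ) + 1) gp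
      simpa using h2
    have h3 : ∀ j ∈ Finset.range d, (P.coeff (j + 1) : ℂ) *
        (n • Complex.exp ((j : ℂ) + 1) - p • aeval ((j : ℂ) + 1) gp) =
        n * ((P.coeff (j + 1) : ℂ) * Complex.exp ((j : ℂ) + 1)) -
          p * ((P.coeff (j + 1) : ℂ) * ((gp.eval ((j : ℤ) + 1) : ℤ) : ℂ)) := by
      intro j _
      rw [h1, zsmul_eq_mul, nsmul_eq_mul]
      ring
    rw [Finset.sum_congr rfl h3, Finset.sum_sub_distrib, ← Finset.mul_sum, ← Finset.mul_sum, hexp,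
      hM]
    push_cast
    ring
  have hle : ‖(M : ℂ)‖ ≤ A * (c ^ p / (p - 1).factorial) := by
    rw [hMeq, norm_neg, hA, Finset.sum_mul]
    refine (norm_sum_le _ _).trans (Finset.sum_le_sum fun j hj => ?_)
    rw [norm_mul]
    gcongr
    · simp
    · exact hgp (hroot j hj)
  have hlt := hle.trans_lt (hN p (by omega))
  rw [Complex.norm_intCast] at hlt
  have : (1 : ℝ) ≤ |(M : ℝ)| := by
    exact_mod_cast Int.one_le_abs hMne
  linarith

open Polynomial in
theorem transcendental_exp_one : Transcendental ℤ (Real.exp 1) := by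
  rw [transcendental_iff]
  intro P hP
  by_contra hne
  -- Dividing out the largest power of X makes the constant coefficient non-zero; the root e is kept
  -- because e ≠ 0.
  obtain ⟨Q, hQ, hdvd⟩ := exists_eq_pow_rootMultiplicity_mul_and_not_dvd P hne 0
  rw [C_0, sub_zero, X_dvd_iff] at hdvd
  rw [C_0, sub_zero] at hQ
  refine aeval_exp_one_ne_zero_of_coeff_zero_ne_zero hdvd ?_
  rw [hQ, map_mul, map_pow, aeval_X] at hP
  have h1 : aeval (Real.exp 1) Q = 0 := by
    rcases mul_eq_zero.1 hP with h | h
    · exact absurd h (pow_ne_zero _ (Real.exp_ne_zero 1))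
    · exact h
  have h2 := aeval_algebraMap_apply ℂ (Real.exp 1) Q
  rw [h1] at h2
  simpa using h2

theorem profileMap_injective : Function.Injective profileMap := by
  intro k k' hkk
  classical
  set S := k.support ∪ k'.support with hS
  set L : ℕ := ∏ ℓ ∈ S, (ℓ : ℕ) with hL
  have hLpos : 0 < L := Finset.prod_pos fun ℓ _ => ℓ.pos
  set t := Real.exp (1 / (L : ℝ)) with ht
  have hpow : ∀ ℓ ∈ S, t ^ (L / (ℓ : ℕ)) = Real.exp (1 / (ℓ : ℝ)) := by
    intro ℓ hℓ
    have hdvd : (ℓ : ℕ) ∣ L := Finset.dvd_prod_of_mem (fun ℓ : ℕ+ => (ℓ : ℕ)) hℓ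
    rw [ht, ← Real.exp_nat_mul, Nat.cast_div hdvd (by simp)]
    congr 1
    have : (L : ℝ) ≠ 0 := by positivity
    field_simp
  have htr : Transcendental ℤ t := by
    intro halg
    refine transcendental_exp_one ?_
    have : Real.exp 1 = t ^ L := by
      rw [ht, ← Real.exp_nat_mul]
      congr 1
      have : (L : ℝ) ≠ 0 := by positivity
      field_simp
    rw [this]
    exact halg.pow L
  set Q : Polynomial ℤ := ∑ ℓ ∈ S,
    Polynomial.C ((k ℓ : ℤ) - k' ℓ) * Polynomial.X ^ (L / (ℓ : ℕ)) with hQ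
  have hsum : ∀ j : ℕ+ →₀ ℕ, j.support ⊆ S →
      profileMap j = ∑ ℓ ∈ S, (j ℓ : ℝ) * Real.exp (1 / (ℓ : ℝ)) := fun j hj =>
    Finsupp.sum_of_support_subset _ hj _ (by simp)
  have hQ0 : Q = 0 := by
    refine transcendental_iff.1 htr Q ?_
    rw [hsum k Finset.subset_union_left, hsum k' Finset.subset_union_right, ← sub_eq_zero,
      ← Finset.sum_sub_distrib] at hkk
    rw [hQ, map_sum, ← hkk]
    refine Finset.sum_congr rfl fun ℓ hℓ => ?_
    rw [← hpow ℓ hℓ]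
    simp
    ring
  ext ℓ
  by_cases hℓ : ℓ ∈ S
  · have h1 : Q.coeff (L / (ℓ : ℕ)) = (k ℓ : ℤ) - k' ℓ := by
      rw [hQ, Polynomial.finsetSum_coeff, Finset.sum_eq_single_of_mem ℓ hℓ]
      · rw [Polynomial.coeff_C_mul_X_pow, if_pos rfl]
      -- Distinct indices give distinct exponents, since (L/ℓ)·ℓ = L recovers ℓ; no two terms of Q
      -- merge.
      · intro r hr hne
        rw [Polynomial.coeff_C_mul_X_pow, if_neg]
        intro heq
        apply hne
        obtain ⟨u, hu⟩ := Finset.dvd_prod_of_mem (fun ℓ : ℕ+ => (ℓ : ℕ)) hr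
        obtain ⟨v, hv⟩ := Finset.dvd_prod_of_mem (fun ℓ : ℕ+ => (ℓ : ℕ)) hℓ
        change L = _ at hu hv
        have e1 : L / (r : ℕ) = u := by rw [hu]; exact Nat.mul_div_cancel_left _ r.pos
        have e2 : L / (ℓ : ℕ) = v := by rw [hv]; exact Nat.mul_div_cancel_left _ ℓ.pos
        rw [e1, e2] at heq
        subst heq
        have hv0 : 0 < v := Nat.pos_of_ne_zero (by rintro rfl; omega)
        exact PNat.coe_injective (Nat.eq_of_mul_eq_mul_right hv0 (hu.symm.trans hv))
    rw [hQ0, Polynomial.coeff_zero] at h1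
    omega
  · rw [hS, Finset.mem_union, not_or, Finsupp.notMem_support_iff, Finsupp.notMem_support_iff] at hℓ
    rw [hℓ.1, hℓ.2]

/-! ### Local behaviour at a zero -/

/-- Near a zero of multiplicity `k + 1`, the analytic function `f`, its derivative and
`f'² - f f''` are powers of `x - x₀` times non-vanishing analytic functions `u`, `v`, `w`. -/
theorem exists_local_factorization {f : ℝ → ℝ} {x₀ : ℝ} (hf : AnalyticAt ℝ f x₀)
    (htop : analyticOrderAt f x₀ ≠ ⊤) (h0 : f x₀ = 0) :
    ∃ (k : ℕ) (u v w : ℝ → ℝ), AnalyticAt ℝ u x₀ ∧ AnalyticAt ℝ v x₀ ∧ AnalyticAt ℝ w x₀ ∧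
      u x₀ ≠ 0 ∧ v x₀ = (k + 1) * u x₀ ∧ w x₀ = (k + 1) * u x₀ ^ 2 ∧
      ∀ᶠ x in 𝓝 x₀, f x = (x - x₀) ^ (k + 1) * u x ∧ deriv f x = (x - x₀) ^ k * v x ∧
        deriv f x ^ 2 - f x * deriv (deriv f) x = (x - x₀) ^ (2 * k) * w x := by
  obtain ⟨u, hu, hu0, hfu⟩ := hf.analyticOrderAt_ne_top.1 htop
  obtain ⟨k, hk⟩ : ∃ k, analyticOrderNatAt f x₀ = k + 1 := by
    refine Nat.exists_eq_succ_of_ne_zero fun h => hu0 ?_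
    have := hfu.self_of_nhds
    rw [h0, h] at this
    simpa using this.symm
  rw [hk] at hfu
  simp only [smul_eq_mul] at hfu
  set v : ℝ → ℝ := fun x => (k + 1) * u x + (x - x₀) * deriv u x with hv
  have hva : AnalyticAt ℝ v x₀ := by
    have := hu.deriv
    fun_prop
  set w : ℝ → ℝ := fun x => v x ^ 2 - k * u x * v x - (x - x₀) * u x * deriv v x with hw
  have hwa : AnalyticAt ℝ w x₀ := by
    have := hva.deriv
    fun_prop
  have hd : ∀ᶠ x in 𝓝 x₀, deriv f x = (x - x₀) ^ k * v x := by
    filter_upwards [hfu.eventually_nhds, hu.eventually_analyticAt] with x hx hux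
    rw [EventuallyEq.deriv_eq hx]
    have h1 : HasDerivAt (fun y : ℝ => (y - x₀) ^ (k + 1)) (((k + 1 : ℕ) : ℝ) * (x - x₀) ^ k) x := by
      simpa using ((hasDerivAt_id x).sub_const x₀).fun_pow (k + 1)
    rw [(h1.fun_mul hux.differentiableAt.hasDerivAt).deriv, hv]
    push_cast
    ring
  refine ⟨k, u, v, w, hu, hva, hwa, hu0, by simp [hv], by simp [hw, hv]; ring, ?_⟩
  filter_upwards [hfu, hd, hd.eventually_nhds, hva.eventually_analyticAt] with x hx hdx hdd hvx
  refine ⟨hx, hdx, ?_⟩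
  have h1 : HasDerivAt (fun y : ℝ => (y - x₀) ^ k) ((k : ℝ) * (x - x₀) ^ (k - 1)) x := by
    simpa using ((hasDerivAt_id x).sub_const x₀).fun_pow k
  -- The case k = 0 is separate because k - 1 is truncated; the factor k then kills both sides.
  have h2 : (k : ℝ) * (x - x₀) ^ (k - 1) * (x - x₀) = k * (x - x₀) ^ k := by
    rcases k with _ | k
    · simp
    · rw [Nat.add_sub_cancel, mul_assoc, ← pow_succ]
  rw [EventuallyEq.deriv_eq hdd, (h1.fun_mul hvx.differentiableAt.hasDerivAt).deriv, hdx, hx, hw]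
  linear_combination (-(x - x₀) ^ k * u x * v x) * h2

/-- The behaviour near a zero of the functions from which the integrand is built. -/
theorem exists_multiplicity {f : ℝ → ℝ} {x₀ : ℝ} (hf : AnalyticAt ℝ f x₀)
    (htop : analyticOrderAt f x₀ ≠ ⊤) (h0 : f x₀ = 0) :
    ∃ m : ℕ+, Tendsto (fun x => deriv f x / f x) (𝓝[>] x₀) atTop ∧
      Tendsto (fun x => deriv f x / f x) (𝓝[<] x₀) atBot ∧
      Tendsto (fun x => deriv f x ^ 2 / (deriv f x ^ 2 - f x * deriv (deriv f) x))
        (𝓝[≠] x₀) (𝓝 m) ∧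
      ∃ E : ℝ → ℝ, AnalyticAt ℝ E x₀ ∧ E x₀ = Real.exp (1 / (m : ℝ)) ∧ g₂ f =ᶠ[𝓝[≠] x₀] E := by
  obtain ⟨k, u, v, w, hu, hv, hw, hu0, hv0, hw0, hloc⟩ := exists_local_factorization hf htop h0
  have hk : (0 : ℝ) < k + 1 := by positivity
  have hloc' : ∀ᶠ x in 𝓝[≠] x₀, x - x₀ ≠ 0 ∧ f x = (x - x₀) ^ (k + 1) * u x ∧
      deriv f x = (x - x₀) ^ k * v x ∧
      deriv f x ^ 2 - f x * deriv (deriv f) x = (x - x₀) ^ (2 * k) * w x := by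
    filter_upwards [self_mem_nhdsWithin, hloc.filter_mono nhdsWithin_le_nhds] with x hx hx'
    exact ⟨sub_ne_zero.2 hx, hx'⟩
  have hq : ∀ᶠ x in 𝓝[≠] x₀, v x / u x * (x - x₀)⁻¹ = deriv f x / f x := by
    filter_upwards [hloc'] with x ⟨hx, h1, h2, h3⟩
    rw [h1, h2, pow_succ, mul_assoc, mul_div_mul_left _ _ (pow_ne_zero _ hx), mul_comm (x - x₀),
      ← div_div, div_eq_mul_inv (v x / u x)]
  have hvu : Tendsto (fun x => v x / u x) (𝓝 x₀) (𝓝 (k + 1)) := by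
    have : v x₀ / u x₀ = k + 1 := by rw [hv0, mul_div_cancel_right₀ _ hu0]
    rw [← this]
    exact (hv.continuousAt.div hu.continuousAt hu0).tendsto
  have hsub : Tendsto (fun x : ℝ => x - x₀) (𝓝 x₀) (𝓝 0) := by
    have : ContinuousAt (fun x : ℝ => x - x₀) x₀ := by fun_prop
    simpa using this.tendsto
  -- The function E is g₂ with (x - x₀)^(2k) cancelled in the exponent. It is analytic across the
  -- zero, which also keeps g₂' bounded there.
  refine ⟨⟨k + 1, k.succ_pos⟩, ?_, ?_, ?_,
    fun x => Real.exp (w x / (v x ^ 2 + (x - x₀) ^ 2 * u x ^ 2)), ?_, ?_, ?_⟩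
  · have h1 : Tendsto (fun x : ℝ => (x - x₀)⁻¹) (𝓝[>] x₀) atTop := by
      refine tendsto_inv_nhdsGT_zero.comp (tendsto_nhdsWithin_iff.2
        ⟨hsub.mono_left nhdsWithin_le_nhds, ?_⟩)
      filter_upwards [self_mem_nhdsWithin] with x hx
      exact mem_Ioi.2 (sub_pos.2 (mem_Ioi.1 hx))
    refine (Tendsto.pos_mul_atTop hk (hvu.mono_left nhdsWithin_le_nhds) h1).congr' ?_
    exact hq.filter_mono (nhdsWithin_mono _ fun x hx => ne_of_gt hx)
  · have h1 : Tendsto (fun x : ℝ => (x - x₀)⁻¹) (𝓝[<] x₀) atBot := by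
      refine tendsto_inv_nhdsLT_zero.comp (tendsto_nhdsWithin_iff.2
        ⟨hsub.mono_left nhdsWithin_le_nhds, ?_⟩)
      filter_upwards [self_mem_nhdsWithin] with x hx
      exact mem_Iio.2 (sub_neg.2 (mem_Iio.1 hx))
    refine (Tendsto.pos_mul_atBot hk (hvu.mono_left nhdsWithin_le_nhds) h1).congr' ?_
    exact hq.filter_mono (nhdsWithin_mono _ fun x hx => ne_of_lt hx)
  · have hne : w x₀ ≠ 0 := by rw [hw0]; positivity
    have h1 : Tendsto (fun x => v x ^ 2 / w x) (𝓝[≠] x₀) (𝓝 (v x₀ ^ 2 / w x₀)) :=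
      ((hv.continuousAt.pow 2).div hw.continuousAt hne).tendsto.mono_left nhdsWithin_le_nhds
    have h2 : v x₀ ^ 2 / w x₀ = (k : ℝ) + 1 := by
      rw [hv0, hw0]
      field_simp
    rw [h2] at h1
    simp only [PNat.mk_coe, Nat.cast_add, Nat.cast_one]
    refine h1.congr' ?_
    filter_upwards [hloc'] with x ⟨hx, h1, h2, h3⟩
    rw [h3, h2, mul_pow, ← pow_mul, mul_comm k 2, mul_div_mul_left _ _ (pow_ne_zero _ hx)]
  · have hne : v x₀ ^ 2 + (x₀ - x₀) ^ 2 * u x₀ ^ 2 ≠ 0 := by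
      rw [hv0]; simp; exact ⟨by positivity, hu0⟩
    refine AnalyticAt.rexp (hw.div ?_ hne)
    fun_prop
  · simp only [PNat.mk_coe, Nat.cast_add, Nat.cast_one, hw0, hv0]
    congr 1
    simp
    field_simp
  · filter_upwards [hloc'] with x ⟨hx, h1, h2, h3⟩
    simp only [g₂]
    rw [h3, h1, h2]
    congr 1
    have : ((x - x₀) ^ k * v x) ^ 2 + ((x - x₀) ^ (k + 1) * u x) ^ 2 =
        (x - x₀) ^ (2 * k) * (v x ^ 2 + (x - x₀) ^ 2 * u x ^ 2) := by ring
    rw [this, mul_div_mul_left _ _ (pow_ne_zero _ hx)]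

theorem eventually_ne_zero_of_analyticOrderAt {f : ℝ → ℝ} {x₀ : ℝ} (hf : AnalyticAt ℝ f x₀)
    (htop : analyticOrderAt f x₀ ≠ ⊤) : ∀ᶠ x in 𝓝[≠] x₀, f x ≠ 0 := by
  refine hf.eventually_eq_zero_or_eventually_ne_zero.resolve_left fun h => htop ?_
  exact analyticOrderAt_eq_top.2 h

theorem analyticAt_g₂ {f : ℝ → ℝ} {x₀ : ℝ} (hf : AnalyticAt ℝ f x₀) (h0 : f x₀ ≠ 0) :
    AnalyticAt ℝ (g₂ f) x₀ := by
  have h1 := hf.deriv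
  have h2 := h1.deriv
  refine AnalyticAt.rexp (AnalyticAt.div ?_ ?_ (by positivity)) <;> fun_prop

theorem hasDerivAt_deriv_div {f : ℝ → ℝ} {x₀ : ℝ} (hf : AnalyticAt ℝ f x₀) (h0 : f x₀ ≠ 0) :
    HasDerivAt (fun x => deriv f x / f x)
      (-((deriv f x₀ ^ 2 - f x₀ * deriv (deriv f) x₀) / f x₀ ^ 2)) x₀ := by
  refine (hf.deriv.differentiableAt.hasDerivAt.fun_div
    hf.differentiableAt.hasDerivAt h0).congr_deriv ?_
  ring

theorem analyticAt_deriv_div {f : ℝ → ℝ} {x₀ : ℝ} (hf : AnalyticAt ℝ f x₀) (h0 : f x₀ ≠ 0) :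
    AnalyticAt ℝ (fun x => deriv f x / f x) x₀ :=
  hf.deriv.div hf h0

theorem g₂_congr {f F : ℝ → ℝ} {x : ℝ} (h : f =ᶠ[𝓝 x] F) : g₂ f =ᶠ[𝓝 x] g₂ F := by
  filter_upwards [h, h.deriv, h.deriv.deriv] with y h1 h2 h3
  simp only [g₂, h1, h2, h3]

theorem integrand_congr {f F : ℝ → ℝ} {x : ℝ} (h : ℝ → ℝ) (σ : EReal) (hfF : f =ᶠ[𝓝 x] F) :
    integrand h σ f (g₂ f) x = integrand h σ F (g₂ F) x := by
  simp only [integrand, hfF.eq_of_nhds, hfF.deriv_eq, hfF.deriv.deriv_eq,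
    (g₂_congr hfF).eq_of_nhds, (g₂_congr hfF).deriv_eq]

theorem boundaryTerm_congr {f F : ℝ → ℝ} {x : ℝ} (h : ℝ → ℝ) (σ : EReal) (hfF : f =ᶠ[𝓝 x] F) :
    boundaryTerm h σ f (g₂ f) x = boundaryTerm h σ F (g₂ F) x := by
  simp only [boundaryTerm, hfF.eq_of_nhds, hfF.deriv_eq, (g₂_congr hfF).eq_of_nhds]

/-! ### Piecewise continuous functions and their primitives -/

theorem PiecewiseContinuous.countable {h : ℝ → ℝ} (hh : PiecewiseContinuous h) :
    {x | ¬ ContinuousAt h x}.Countable := by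
  have : {x | ¬ ContinuousAt h x} = ⋃ n : ℕ, {x | ¬ ContinuousAt h x} ∩ Icc (-(n : ℝ)) n := by
    ext x
    simp only [mem_iUnion, mem_inter_iff, mem_Icc, ← abs_le]
    exact ⟨fun hx => (exists_nat_ge |x|).imp fun n hn => ⟨hx, hn⟩, fun ⟨_, hx, _⟩ => hx⟩
  rw [this]
  exact countable_iUnion fun n => (hh.1 n).countable

theorem measurable_of_countable_not_continuousAt {h : ℝ → ℝ}
    (hh : {x | ¬ ContinuousAt h x}.Countable) : Measurable h := by
  classical
  set D := {x | ¬ ContinuousAt h x} with hD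
  have h1 : Measurable (D.piecewise (fun _ => (0 : ℝ)) h) := by
    refine continuousOn_const.measurable_piecewise ?_ hh.measurableSet
    intro x hx
    exact (not_not.1 hx : ContinuousAt h x).continuousWithinAt
  refine h1.measurable_of_countable_ne (hh.mono fun x hx => ?_)
  by_contra hxD
  exact hx (piecewise_eq_of_notMem _ _ _ hxD)

theorem PiecewiseContinuous.exists_bound {h : ℝ → ℝ} (hh : PiecewiseContinuous h) (x : ℝ) :
    ∃ C, ∀ᶠ t in 𝓝 x, |h t| ≤ C := by
  obtain ⟨⟨l, hl⟩, ⟨r, hr⟩⟩ := hh.2 x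
  have h1 := hl.abs.eventually_le_const (lt_add_one |l|)
  have h2 := hr.abs.eventually_le_const (lt_add_one |r|)
  refine ⟨max (max (|l| + 1) (|r| + 1)) |h x|, ?_⟩
  rw [← nhdsNE_sup_pure, ← Iio_union_Ioi, nhdsWithin_union, eventually_sup, eventually_sup,
    eventually_pure]
  refine ⟨⟨h1.mono fun t ht => ?_, h2.mono fun t ht => ?_⟩, le_max_right _ _⟩
  · exact ht.trans (le_max_of_le_left (le_max_left _ _))
  · exact ht.trans (le_max_of_le_left (le_max_right _ _))

/-- A function of two variables of the form `P w - P u` has a limit only if `P` has. -/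
theorem HasImproperIntegralLine.exists_tendsto {h : ℝ → ℝ} {v : ℝ}
    (hh : HasImproperIntegralLine h v) :
    ∃ l r : ℝ, Tendsto (fun x => ∫ t in (0 : ℝ)..x, h t) atBot (𝓝 l) ∧
      Tendsto (fun x => ∫ t in (0 : ℝ)..x, h t) atTop (𝓝 r) ∧ r - l = v := by
  set P : ℝ → ℝ := fun x => ∫ t in (0 : ℝ)..x, h t with hP
  have hsub : ∀ u w, ∫ t in u..w, h t = P w - P u := fun u w =>
    (intervalIntegral.integral_interval_sub_left (hh.1 0 w) (hh.1 0 u)).symm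
  have hlim : Tendsto (fun p : ℝ × ℝ => P p.2 - P p.1) (atBot ×ˢ atTop) (𝓝 v) := by
    refine hh.2.congr fun p => hsub _ _
  have hcauchy : Cauchy (map (fun p : ℝ × ℝ => P p.2 - P p.1) (atBot ×ˢ atTop)) :=
    hlim.cauchy_map
  have hr : ∃ r, Tendsto P atTop (𝓝 r) := by
    refine cauchy_map_iff_exists_tendsto.1 ?_
    rw [Metric.cauchy_iff]
    refine ⟨inferInstance, fun ε hε => ?_⟩
    have h1 := hlim.eventually (Metric.ball_mem_nhds v (half_pos hε))
    obtain ⟨s, hs, t, ht, hst⟩ := mem_prod_iff.1 h1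
    -- With one u frozen, P w - P u and P w' - P u are both close to v, which is the Cauchy
    -- condition for P at +∞.
    obtain ⟨u, hu⟩ := (inferInstance : (atBot : Filter ℝ).NeBot).nonempty_of_mem hs
    refine ⟨P '' t, image_mem_map ht, ?_⟩
    rintro _ ⟨w, hw, rfl⟩ _ ⟨w', hw', rfl⟩
    have h2 := hst (mk_mem_prod hu hw)
    have h3 := hst (mk_mem_prod hu hw')
    simp only [mem_ofPred_eq] at h2 h3
    have h4 := dist_triangle_right (P w - P u) (P w' - P u) v
    rw [dist_sub_right] at h4
    linarith
  obtain ⟨r, hr⟩ := hr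
  have hl : Tendsto P atBot (𝓝 (r - v)) := by
    rw [Metric.tendsto_nhds]
    intro ε hε
    have h1 := hlim.eventually (Metric.ball_mem_nhds v (half_pos hε))
    obtain ⟨s, hs, t, ht, hst⟩ := mem_prod_iff.1 h1
    obtain ⟨w, hw, hw'⟩ := ((eventually_mem_set.2 ht).and
      (hr.eventually (Metric.ball_mem_nhds r (half_pos hε)))).exists
    filter_upwards [hs] with u hu
    have h2 := hst (mk_mem_prod hu hw)
    simp only [mem_ofPred_eq, Real.dist_eq, abs_lt] at h2 hw' ⊢
    constructor <;> linarith [h2.1, h2.2, hw'.1, hw'.2]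
  exact ⟨r - v, r, hl, hr, by ring⟩

/-- Changing the base point, even to ±∞, only shifts by a constant. Continuity, the derivative and
the total increment of H therefore do not depend on σ. -/
theorem exists_primitive_eq {h : ℝ → ℝ} {v : ℝ} (hh : HasImproperIntegralLine h v) (σ : EReal) :
    ∃ k : ℝ, ∀ x, primitive h σ x = (∫ t in (0 : ℝ)..x, h t) - k := by
  obtain ⟨l, r, hl, hr, -⟩ := hh.exists_tendsto
  have hsub : ∀ u w, ∫ t in u..w, h t = (∫ t in (0 : ℝ)..w, h t) - ∫ t in (0 : ℝ)..u, h t :=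
    fun u w => (intervalIntegral.integral_interval_sub_left (hh.1 0 w) (hh.1 0 u)).symm
  unfold primitive
  split_ifs with h1 h2
  · refine ⟨l, fun x => Tendsto.limUnder_eq ?_⟩
    exact (hl.const_sub _).congr fun s => (hsub s x).symm
  · refine ⟨r, fun x => Tendsto.limUnder_eq ?_⟩
    exact (hr.const_sub _).congr fun s => (hsub s x).symm
  · exact ⟨_, fun x => hsub _ x⟩

theorem exists_tendsto_primitive {h : ℝ → ℝ} {v : ℝ} (hh : HasImproperIntegralLine h v)
    (σ : EReal) : ∃ l r : ℝ, Tendsto (primitive h σ) atBot (𝓝 l) ∧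
      Tendsto (primitive h σ) atTop (𝓝 r) ∧ r - l = v := by
  obtain ⟨k, hk⟩ := exists_primitive_eq hh σ
  obtain ⟨l, r, hl, hr, hv⟩ := hh.exists_tendsto
  refine ⟨l - k, r - k, ?_, ?_, by linarith⟩
  · exact (hl.sub_const k).congr fun x => (hk x).symm
  · exact (hr.sub_const k).congr fun x => (hk x).symm

theorem continuous_primitive {h : ℝ → ℝ} {v : ℝ} (hh : HasImproperIntegralLine h v)
    (σ : EReal) : Continuous (primitive h σ) := by
  obtain ⟨k, hk⟩ := exists_primitive_eq hh σ
  rw [funext hk]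
  exact (intervalIntegral.continuous_primitive hh.1 0).sub continuous_const

theorem hasDerivAt_primitive {h : ℝ → ℝ} {v : ℝ} (hm : Measurable h)
    (hh : HasImproperIntegralLine h v) (σ : EReal) {x : ℝ} (hx : ContinuousAt h x) :
    HasDerivAt (primitive h σ) (h x) x := by
  obtain ⟨k, hk⟩ := exists_primitive_eq hh σ
  rw [funext hk]
  exact (intervalIntegral.integral_hasDerivAt_right (hh.1 0 x)
    hm.stronglyMeasurable.stronglyMeasurableAtFilter hx).sub_const k

/-! ### Integrability of the integrand -/

theorem measurable_integrand {h f : ℝ → ℝ} {σ : EReal} (hm : Measurable h)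
    (hH : Continuous (primitive h σ)) (hf : Measurable f) :
    Measurable (integrand h σ f (g₂ f)) := by
  have h1 := measurable_deriv f
  have h2 := measurable_deriv (deriv f)
  have h3 : Measurable (g₂ f) := by
    unfold g₂
    fun_prop
  have h4 := measurable_deriv (g₂ f)
  have h5 : Measurable fun x => h (deriv f x / f x) := hm.comp (h1.div hf)
  have h6 : Measurable fun x => primitive h σ (deriv f x / f x) := hH.measurable.comp (h1.div hf)
  unfold integrand
  exact ((h5.mul h3).mul (((h1.pow_const 2).sub (hf.mul h2)).div (hf.pow_const 2))).sub (h6.mul h4)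

/-- Outside the interval f may be arbitrary, so it is replaced by 0 there. Derivatives at points of
the open interval are unaffected. -/
theorem aestronglyMeasurable_integrand {h f : ℝ → ℝ} {σ : EReal} {c d : ℝ} (hm : Measurable h)
    (hH : Continuous (primitive h σ)) (hf : ContinuousOn f (Ioo c d)) :
    AEStronglyMeasurable (integrand h σ f (g₂ f)) (volume.restrict (Ioo c d)) := by
  classical
  have h1 : Measurable ((Ioo c d).piecewise f fun _ => 0) :=
    hf.measurable_piecewise continuousOn_const measurableSet_Ioo
  refine ⟨_, (measurable_integrand hm hH h1).stronglyMeasurable, ?_⟩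
  filter_upwards [ae_restrict_mem measurableSet_Ioo] with x hx
  refine integrand_congr h σ ?_
  filter_upwards [Ioo_mem_nhds hx.1 hx.2] with y hy
  exact (piecewise_eq_of_mem _ _ _ hy).symm

/-- Compactness of [c, d] turns local bounds into integrability. Punctured neighbourhoods suffice,
which admits zeros of f and endpoints as centres. -/
theorem intervalIntegrable_of_locally_bounded {φ : ℝ → ℝ} {c d : ℝ} (hcd : c ≤ d)
    (hm : AEStronglyMeasurable φ (volume.restrict (Ioo c d)))
    (hb : ∀ x ∈ Icc c d, ∃ C, ∀ᶠ y in 𝓝[≠] x, y ∈ Ioo c d → |φ y| ≤ C) :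
    IntervalIntegrable φ volume c d := by
  rw [intervalIntegrable_iff_integrableOn_Ioo_of_le hcd,
    ← integrable_indicator_iff measurableSet_Ioo]
  have hm' : AEStronglyMeasurable ((Ioo c d).indicator φ) volume :=
    (aestronglyMeasurable_indicator_iff measurableSet_Ioo).2 hm
  have h1 : LocallyIntegrableOn ((Ioo c d).indicator φ) (Icc c d) := by
    intro x hx
    refine Measure.FiniteAtFilter.integrableAtFilter
      ⟨univ, univ_mem, by simpa using hm'⟩
      ((volume.finiteAt_nhds x).filter_mono nhdsWithin_le_nhds) ?_
    obtain ⟨C, hC⟩ := hb x hx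
    refine ⟨max (max C 0) |(Ioo c d).indicator φ x|, ?_⟩
    rw [eventually_map]
    refine Eventually.filter_mono nhdsWithin_le_nhds ?_
    rw [← nhdsNE_sup_pure, eventually_sup, eventually_pure]
    refine ⟨hC.mono fun y hy => ?_, le_max_right _ _⟩
    by_cases hyI : y ∈ Ioo c d
    · simp only [Function.comp_apply, indicator_of_mem hyI, Real.norm_eq_abs]
      exact (hy hyI).trans (le_max_of_le_left (le_max_left _ _))
    · simp [Function.comp_apply, indicator_of_notMem hyI]
  have h2 := h1.integrableOn_isCompact isCompact_Icc
  refine (integrableOn_iff_integrable_of_support_subset ?_).1 h2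
  exact support_indicator_subset.trans Ioo_subset_Icc_self

theorem exists_bound_integrand_of_ne_zero {h f : ℝ → ℝ} {σ : EReal} {x₀ : ℝ}
    (hh : PiecewiseContinuous h) (hH : Continuous (primitive h σ)) (hf : AnalyticAt ℝ f x₀)
    (h0 : f x₀ ≠ 0) : ∃ C, ∀ᶠ x in 𝓝 x₀, |integrand h σ f (g₂ f) x| ≤ C := by
  have hq := (analyticAt_deriv_div hf h0).continuousAt
  obtain ⟨C, hC⟩ := hh.exists_bound (deriv f x₀ / f x₀)
  have hC' := hq.tendsto.eventually hC
  set A : ℝ → ℝ := fun x =>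
    C * |g₂ f x * ((deriv f x ^ 2 - f x * deriv (deriv f) x) / f x ^ 2)| +
      |primitive h σ (deriv f x / f x) * deriv (g₂ f) x| with hA
  have hAc : ContinuousAt A x₀ := by
    have h1 := (analyticAt_g₂ hf h0).continuousAt
    have h2 := (analyticAt_g₂ hf h0).deriv.continuousAt
    have h3 := hf.deriv.continuousAt
    have h4 := hf.deriv.deriv.continuousAt
    have h5 := hf.continuousAt
    have h6 : ContinuousAt (fun x => primitive h σ (deriv f x / f x)) x₀ :=
      hH.continuousAt.comp hq
    have h7 : f x₀ ^ 2 ≠ 0 := pow_ne_zero _ h0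
    exact (continuousAt_const.mul (h1.mul (((h3.pow 2).sub (h5.mul h4)).div (h5.pow 2) h7)).abs).add
      (h6.mul h2).abs
  refine ⟨A x₀ + 1, ?_⟩
  filter_upwards [hC', hAc.eventually_le_const (lt_add_one (A x₀))] with x h1 h2
  refine le_trans ?_ h2
  rw [integrand, hA]
  refine (abs_sub _ _).trans (add_le_add_left ?_ _)
  rw [mul_assoc, abs_mul]
  exact mul_le_mul_of_nonneg_right h1 (abs_nonneg _)

/-- With q = f'/f, the first term is h(q) q² · g₂ · (f'² - f f'')/f'². Here |q| → ∞, so the decay of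
h bounds h(q) q², and the last factor tends to 1/m. In the second term H(q) is bounded by its limits
at ±∞, and g₂' by analyticity of the extension of g₂. -/
theorem exists_bound_integrand_of_zero {h f : ℝ → ℝ} {σ : EReal} {x₀ l r : ℝ}
    (hO : Asymptotics.IsBigO (cocompact ℝ) h (fun x : ℝ => 1 / x ^ 2))
    (hl : Tendsto (primitive h σ) atBot (𝓝 l)) (hr : Tendsto (primitive h σ) atTop (𝓝 r))
    (hf : AnalyticAt ℝ f x₀) (htop : analyticOrderAt f x₀ ≠ ⊤) (h0 : f x₀ = 0) :
    ∃ C, ∀ᶠ x in 𝓝[≠] x₀, |integrand h σ f (g₂ f) x| ≤ C := by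
  obtain ⟨m, hqr, hql, hmul, E, hE, -, hgE⟩ := exists_multiplicity hf htop h0
  have hne := eventually_ne_zero_of_analyticOrderAt hf htop
  have hq : Tendsto (fun x => deriv f x / f x) (𝓝[≠] x₀) (cocompact ℝ) := by
    rw [← Iio_union_Ioi, nhdsWithin_union, cocompact_eq_atBot_atTop]
    exact (hql.sup_sup hqr)
  have hH : ∀ᶠ x in 𝓝[≠] x₀, |primitive h σ (deriv f x / f x)| ≤ max (|l| + 1) (|r| + 1) := by
    rw [← Iio_union_Ioi, nhdsWithin_union, eventually_sup]
    have h1 := (hl.comp hql).abs.eventually_le_const (lt_add_one |l|)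
    have h2 := (hr.comp hqr).abs.eventually_le_const (lt_add_one |r|)
    exact ⟨h1.mono fun x hx => hx.trans (le_max_left _ _),
      h2.mono fun x hx => hx.trans (le_max_right _ _)⟩
  obtain ⟨C, hC⟩ := hO.bound
  have hC' := hq.eventually hC
  have hinv : Tendsto (fun x => (deriv f x ^ 2 - f x * deriv (deriv f) x) / deriv f x ^ 2)
      (𝓝[≠] x₀) (𝓝 ((m : ℝ)⁻¹)) := by
    refine (hmul.inv₀ (by simp)).congr fun x => ?_
    rw [inv_div]
  have hg' : deriv (g₂ f) =ᶠ[𝓝[≠] x₀] deriv E := by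
    have := eventually_eventually_nhdsWithin.2 hgE
    filter_upwards [this, self_mem_nhdsWithin] with x hx hx'
    refine EventuallyEq.deriv_eq ?_
    rwa [IsOpen.nhdsWithin_eq isOpen_compl_singleton hx'] at hx
  set K := max (|l| + 1) (|r| + 1) with hK
  have hb1 := (hinv.mul (hE.continuousAt.tendsto.mono_left nhdsWithin_le_nhds)).abs
  have hb2 := (hE.deriv.continuousAt.tendsto.mono_left
    (nhdsWithin_le_nhds (s := {x₀}ᶜ))).abs
  refine ⟨|C| * (|(m : ℝ)⁻¹ * E x₀| + 1) + K * (|deriv E x₀| + 1), ?_⟩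
  filter_upwards [hH, hC', hg', hgE, hne, hb1.eventually_le_const (lt_add_one _),
    hb2.eventually_le_const (lt_add_one _),
    hq.eventually (isCompact_singleton (x := (0 : ℝ))).compl_mem_cocompact]
    with x h1 h2 h3 h4 h5 h6 h7 h8
  have hd : deriv f x ≠ 0 := by
    rintro h9
    simp [h9] at h8
  rw [integrand, h3, h4]
  refine (abs_sub _ _).trans (add_le_add ?_ ?_)
  · have e1 : |h (deriv f x / f x) * E x *
        ((deriv f x ^ 2 - f x * deriv (deriv f) x) / f x ^ 2)| =
        (|h (deriv f x / f x)| * (deriv f x / f x) ^ 2) *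
          |(deriv f x ^ 2 - f x * deriv (deriv f) x) / deriv f x ^ 2 * E x| := by
      rw [← abs_of_nonneg (sq_nonneg (deriv f x / f x)), ← abs_mul, ← abs_mul]
      congr 1
      field_simp
    rw [e1]
    have e2 : |h (deriv f x / f x)| * (deriv f x / f x) ^ 2 ≤ |C| := by
      have hpos : 0 < (deriv f x / f x) ^ 2 := by positivity
      rw [← le_div_iff₀ hpos]
      refine h2.trans ?_
      rw [Real.norm_eq_abs, abs_of_pos (by positivity), mul_one_div]
      gcongr
      exact le_abs_self C
    exact mul_le_mul e2 h6 (abs_nonneg _) (abs_nonneg _)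
  · rw [abs_mul]
    exact mul_le_mul h1 h7 (abs_nonneg _) ((abs_nonneg _).trans h1)

/-! ### The integral over intervals without zeros -/

theorem countable_of_eventually_nhdsNE_notMem {S : Set ℝ} (hS : ∀ x ∈ S, ∀ᶠ y in 𝓝[≠] x, y ∉ S) :
    S.Countable := by
  have h1 : IsDiscrete S := by
    rw [isDiscrete_iff_nhdsNE]
    intro x hx
    rw [← disjoint_iff, disjoint_principal_right]
    exact hS x hx
  have h2 : DiscreteTopology S := isDiscrete_iff_discreteTopology.1 h1
  exact countable_coe_iff.1 (TopologicalSpace.separableSpace_iff_countable.1 inferInstance)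

/-- By the identity theorem each point of a level set of q is either isolated in it or a point of
local constancy. Used with D the discontinuities of h and q = f'/f, where the chain rule for H(q)
could fail. -/
theorem countable_preimage_of_analyticOnNhd {q : ℝ → ℝ} {U D : Set ℝ} (hq : AnalyticOnNhd ℝ q U)
    (hD : D.Countable) : {x | x ∈ U ∧ q x ∈ D ∧ ¬ ∀ᶠ y in 𝓝 x, q y = q x}.Countable := by
  refine (hD.biUnion (t := fun t _ => {x | x ∈ U ∧ q x = t ∧ ¬ ∀ᶠ y in 𝓝 x, q y = q x})
    fun t _ => countable_of_eventually_nhdsNE_notMem ?_).mono ?_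
  · rintro x ⟨hx, hxt, hc⟩
    rcases (hq x hx).eventually_eq_or_eventually_ne (analyticAt_const (v := t)) with h | h
    · exact absurd (hxt ▸ h) hc
    · exact h.mono fun y hy hyS => hy hyS.2.1
  · rintro x ⟨hx, hxD, hc⟩
    exact mem_iUnion₂.2 ⟨q x, hxD, hx, rfl, hc⟩

theorem hasDerivAt_boundaryTerm {f h : ℝ → ℝ} {σ : EReal} {x : ℝ} (hf : AnalyticAt ℝ f x)
    (h0 : f x ≠ 0)
    (hH : ContinuousAt h (deriv f x / f x) →
      HasDerivAt (primitive h σ) (h (deriv f x / f x)) (deriv f x / f x))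
    (hx : ContinuousAt h (deriv f x / f x) ∨
      ∀ᶠ y in 𝓝 x, deriv f y / f y = deriv f x / f x) :
    HasDerivAt (fun y => -boundaryTerm h σ f (g₂ f) y) (integrand h σ f (g₂ f) x) x := by
  have hq := hasDerivAt_deriv_div hf h0
  have hg := (analyticAt_g₂ hf h0).differentiableAt.hasDerivAt
  have hHq : HasDerivAt (fun y => primitive h σ (deriv f y / f y))
      (h (deriv f x / f x) * -((deriv f x ^ 2 - f x * deriv (deriv f) x) / f x ^ 2)) x := by
    rcases hx with hx | hx
    · exact (hH hx).comp x hq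
    -- Where f'/f is locally constant its derivative vanishes, so the value of h at a possible
    -- discontinuity is multiplied by 0.
    · have h1 : HasDerivAt (fun y => deriv f y / f y) 0 x :=
        (hasDerivAt_const x (deriv f x / f x)).congr_of_eventuallyEq hx
      rw [hq.unique h1, mul_zero]
      refine (hasDerivAt_const x (primitive h σ (deriv f x / f x))).congr_of_eventuallyEq ?_
      filter_upwards [hx] with y hy
      rw [hy]
  refine (hHq.fun_mul hg).fun_neg.congr_deriv ?_
  rw [integrand]
  ring

theorem continuousAt_boundaryTerm {f h : ℝ → ℝ} {σ : EReal} {x : ℝ}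
    (hH : Continuous (primitive h σ)) (hf : ContDiffAt ℝ 2 f x) (h0 : f x ≠ 0) :
    ContinuousAt (boundaryTerm h σ f (g₂ f)) x := by
  have h1 : ContDiffAt ℝ 1 (deriv f) x := hf.derivWithin (by norm_num)
  have h2 : ContDiffAt ℝ 0 (deriv (deriv f)) x := h1.derivWithin (by norm_num)
  have c0 := hf.continuousAt
  have c1 := h1.continuousAt
  have hne : deriv f x ^ 2 + f x ^ 2 ≠ 0 := by positivity
  exact (hH.continuousAt.comp (c1.div c0 h0)).mul (Real.continuous_exp.continuousAt.comp
    (((c1.pow 2).sub (c0.mul h2.continuousAt)).div ((c1.pow 2).add (c0.pow 2)) hne))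

/-- The fundamental theorem of calculus with a countable exceptional set: the points where f'/f
meets a discontinuity of h without being locally constant. -/
theorem integral_integrand {f h : ℝ → ℝ} {σ : EReal} {v u w : ℝ} (hh : PiecewiseContinuous h)
    (hI : HasImproperIntegralLine h v) (huw : u ≤ w) (hf : AnalyticOnNhd ℝ f (Icc u w))
    (hne : ∀ x ∈ Icc u w, f x ≠ 0) :
    IntervalIntegrable (integrand h σ f (g₂ f)) volume u w ∧
      ∫ x in u..w, integrand h σ f (g₂ f) x =
        boundaryTerm h σ f (g₂ f) u - boundaryTerm h σ f (g₂ f) w := by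
  have hm := measurable_of_countable_not_continuousAt hh.countable
  have hH := continuous_primitive hI σ
  have hint : IntervalIntegrable (integrand h σ f (g₂ f)) volume u w := by
    refine intervalIntegrable_of_locally_bounded huw
      (aestronglyMeasurable_integrand hm hH (hf.continuousOn.mono Ioo_subset_Icc_self))
      fun x hx => ?_
    obtain ⟨C, hC⟩ := exists_bound_integrand_of_ne_zero hh hH (hf x hx) (hne x hx)
    exact ⟨C, (hC.filter_mono nhdsWithin_le_nhds).mono fun y hy _ => hy⟩
  refine ⟨hint, ?_⟩
  have hq : AnalyticOnNhd ℝ (fun x => deriv f x / f x) (Icc u w) := fun x hx =>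
    analyticAt_deriv_div (hf x hx) (hne x hx)
  have h1 := integral_eq_of_hasDerivAt_off_countable_of_le
    (fun y => -boundaryTerm h σ f (g₂ f) y) _ huw
    (countable_preimage_of_analyticOnNhd hq hh.countable)
    (fun x hx => (continuousAt_boundaryTerm hH (hf x hx).contDiffAt
      (hne x hx)).continuousWithinAt.neg) (fun x hx => ?_) hint
  · rw [h1]
    ring
  · have hxI := Ioo_subset_Icc_self hx.1
    refine hasDerivAt_boundaryTerm (hf x hxI) (hne x hxI)
      (fun hc => hasDerivAt_primitive hm hI σ hc) ?_
    by_contra hcon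
    rw [not_or] at hcon
    exact hx.2 ⟨hxI, hcon.1, hcon.2⟩

theorem hasImproperIntegralIoo_integrand {f h : ℝ → ℝ} {σ : EReal} {v c d R L : ℝ}
    (hh : PiecewiseContinuous h) (hI : HasImproperIntegralLine h v) (hcd : c < d)
    (hf : AnalyticOnNhd ℝ f (Ioo c d)) (hne : ∀ x ∈ Ioo c d, f x ≠ 0)
    (hR : Tendsto (boundaryTerm h σ f (g₂ f)) (𝓝[>] c) (𝓝 R))
    (hL : Tendsto (boundaryTerm h σ f (g₂ f)) (𝓝[<] d) (𝓝 L)) :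
    HasImproperIntegralIoo (integrand h σ f (g₂ f)) c d (R - L) := by
  have key : ∀ u w : ℝ, c < u → u ≤ w → w < d →
      IntervalIntegrable (integrand h σ f (g₂ f)) volume u w ∧
      ∫ x in u..w, integrand h σ f (g₂ f) x =
        boundaryTerm h σ f (g₂ f) u - boundaryTerm h σ f (g₂ f) w := by
    intro u w hu huw hw
    have hsub : Icc u w ⊆ Ioo c d := fun x hx => ⟨hu.trans_le hx.1, hx.2.trans_lt hw⟩
    exact integral_integrand hh hI huw (hf.mono hsub) fun x hx => hne x (hsub hx)
  refine ⟨hcd, fun u w hu huw hw => (key u w hu huw hw).1, ?_⟩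
  have h1 : Tendsto (fun p : ℝ × ℝ => boundaryTerm h σ f (g₂ f) p.1 - boundaryTerm h σ f (g₂ f) p.2)
      (𝓝[>] c ×ˢ 𝓝[<] d) (𝓝 (R - L)) :=
    (hR.comp tendsto_fst).sub (hL.comp tendsto_snd)
  refine h1.congr' ?_
  obtain ⟨e, hce, hed⟩ := exists_between hcd
  filter_upwards [prod_mem_prod (Ioo_mem_nhdsGT hce) (Ioo_mem_nhdsLT hed)] with p hp
  exact ((key p.1 p.2 hp.1.1 (hp.1.2.trans hp.2.1).le hp.2.2).2).symm

/-! ### Improper integrals with several singular points -/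

theorem HasImproperIntegralIoo.hasImproperIntegral {φ : ℝ → ℝ} {a b v : ℝ}
    (h : HasImproperIntegralIoo φ a b v) : HasImproperIntegral φ a b v := by
  refine ⟨1, fun i => if i = 0 then a else b, fun _ => v, by simp, by simp, fun i hi => ?_, by simp⟩
  obtain rfl : i = 0 := by omega
  simpa using h

theorem HasImproperIntegral.trans {φ : ℝ → ℝ} {a b c v w : ℝ} (h₁ : HasImproperIntegral φ a b v)
    (h₂ : HasImproperIntegral φ b c w) : HasImproperIntegral φ a c (v + w) := by
  obtain ⟨m, y, s, hy0, hym, hy, hs⟩ := h₁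
  obtain ⟨n, z, t, hz0, hzn, hz, ht⟩ := h₂
  refine ⟨m + n, fun i => if i < m then y i else z (i - m),
    fun i => if i < m then s i else t (i - m), ?_, ?_, fun i hi => ?_, ?_⟩
  · rcases Nat.eq_zero_or_pos m with rfl | hm
    · simp [hz0, ← hym, hy0]
    · simp [hm, hy0]
  · simp [hzn]
  · dsimp only
    rcases lt_trichotomy (i + 1) m with h | h | h
    · rw [if_pos (by omega), if_pos h, if_pos (by omega)]
      exact hy i (by omega)
    · rw [if_pos (by omega), if_neg (by omega), if_pos (by omega), h, Nat.sub_self, hz0, ← hym, ← h]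
      exact hy i (by omega)
    · rw [if_neg (by omega), if_neg (by omega), if_neg (by omega),
        show i + 1 - m = i - m + 1 by omega]
      exact hz _ (by omega)
  · rw [Finset.sum_range_add, ← hs, ← ht]
    congr 1
    · exact Finset.sum_congr rfl fun i hi => if_pos (Finset.mem_range.1 hi)
    · refine Finset.sum_congr rfl fun i _ => ?_
      simp

/-- Telescoping by induction on the singular points: a new point z inside (a, b) splits the integral
and contributes R z - L z. The endpoints are quantified inside the statement so that the induction
hypothesis applies to both halves. -/
theorem hasImproperIntegral_of_finset {φ R L : ℝ → ℝ} (Z : Finset ℝ) :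
    ∀ {a b : ℝ}, a < b →
      (∀ c d, a ≤ c → c < d → d ≤ b → (∀ z ∈ Z, z ∉ Ioo c d) →
        HasImproperIntegralIoo φ c d (R c - L d)) →
      HasImproperIntegral φ a b (R a - L b + ∑ z ∈ Z with a < z ∧ z < b, (R z - L z)) := by
  classical
  induction Z using Finset.induction_on with
  | empty =>
    intro a b hab H
    simpa using (H a b le_rfl hab le_rfl (by simp)).hasImproperIntegral
  | insert z Z hz ih =>
    intro a b hab H
    by_cases hzab : a < z ∧ z < b
    · have h1 := ih hzab.1 fun c d hc hcd hd hZ => H c d hc hcd (hd.trans hzab.2.le) (by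
        rw [Finset.forall_mem_insert]
        exact ⟨fun hm => absurd hm.2 (not_lt.2 hd), hZ⟩)
      have h2 := ih hzab.2 fun c d hc hcd hd hZ => H c d (hzab.1.le.trans hc) hcd hd (by
        rw [Finset.forall_mem_insert]
        exact ⟨fun hm => absurd hm.1 (not_lt.2 hc), hZ⟩)
      convert h1.trans h2 using 1
      have hsplit : Z.filter (fun x => a < x ∧ x < b) =
          Z.filter (fun x => a < x ∧ x < z) ∪ Z.filter (fun x => z < x ∧ x < b) := by
        ext x
        simp only [Finset.mem_filter, Finset.mem_union]
        constructor
        · rintro ⟨hx, h3, h4⟩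
          rcases lt_trichotomy x z with h | h | h
          · exact Or.inl ⟨hx, h3, h⟩
          · exact absurd (h ▸ hx) hz
          · exact Or.inr ⟨hx, h, h4⟩
        · rintro (⟨hx, h3, h4⟩ | ⟨hx, h3, h4⟩)
          · exact ⟨hx, h3, h4.trans hzab.2⟩
          · exact ⟨hx, hzab.1.trans h3, h4⟩
      have hdisj : Disjoint (Z.filter (fun x => a < x ∧ x < z))
          (Z.filter (fun x => z < x ∧ x < b)) := by
        rw [Finset.disjoint_filter]
        intro x _ h3 h4
        exact lt_asymm h3.2 h4.1
      rw [Finset.filter_insert, if_pos hzab, Finset.sum_insert (by simp [hz]), hsplit,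
        Finset.sum_union hdisj]
      ring
    · rw [Finset.filter_insert, if_neg hzab]
      refine ih hab fun c d hc hcd hd hZ => H c d hc hcd hd ?_
      rw [Finset.forall_mem_insert]
      exact ⟨fun hm => hzab ⟨hc.trans_lt hm.1, hm.2.trans_le hd⟩, hZ⟩

theorem HasImproperIntegralIoo.integral_eq {φ : ℝ → ℝ} {c d v : ℝ}
    (h : HasImproperIntegralIoo φ c d v) (hφ : IntervalIntegrable φ volume c d) :
    ∫ x in c..d, φ x = v := by
  obtain ⟨hcd, -, hlim⟩ := h
  have hc : ContinuousOn (fun x => ∫ t in c..x, φ t) (Icc c d) := by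
    have := intervalIntegral.continuousOn_primitive_interval' hφ left_mem_uIcc
    rwa [uIcc_of_le hcd.le] at this
  have h1 : Tendsto (fun x => ∫ t in c..x, φ t) (𝓝[>] c) (𝓝 0) := by
    have := (hc c (left_mem_Icc.2 hcd.le)).tendsto.mono_left
      (nhdsWithin_le_of_mem (Icc_mem_nhdsGT hcd))
    simpa using this
  have h2 : Tendsto (fun x => ∫ t in c..x, φ t) (𝓝[<] d) (𝓝 (∫ t in c..d, φ t)) :=
    (hc d (right_mem_Icc.2 hcd.le)).tendsto.mono_left (nhdsWithin_le_of_mem (Icc_mem_nhdsLT hcd))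
  have h3 := (h2.comp tendsto_snd).sub (h1.comp (tendsto_fst (f := 𝓝[>] c) (g := 𝓝[<] d)))
  rw [sub_zero] at h3
  refine tendsto_nhds_unique (h3.congr' ?_) hlim
  filter_upwards [prod_mem_prod (Ioo_mem_nhdsGT hcd) (Ioo_mem_nhdsLT hcd)] with p hp
  have hsub : ∀ x ∈ Ioo c d, IntervalIntegrable φ volume c x := fun x hx =>
    hφ.mono_set (uIcc_subset_uIcc left_mem_uIcc (by rw [uIcc_of_le hcd.le]; exact ⟨hx.1.le, hx.2.le⟩))
  exact intervalIntegral.integral_interval_sub_left (hsub _ hp.2) (hsub _ hp.1)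

theorem HasImproperIntegral.integral_eq {φ : ℝ → ℝ} {a b v : ℝ}
    (h : HasImproperIntegral φ a b v) (hφ : IntervalIntegrable φ volume a b) :
    ∫ x in a..b, φ x = v := by
  obtain ⟨m, y, w, rfl, rfl, hy, rfl⟩ := h
  have hmono : ∀ i j, i ≤ j → j ≤ m → y i ≤ y j := by
    intro i j hij
    induction j, hij using Nat.le_induction with
    | base => exact fun _ => le_rfl
    | succ j _ ih => exact fun hj => (ih (by omega)).trans (hy j (by omega)).1.le
  have hint : ∀ k < m, IntervalIntegrable φ volume (y k) (y (k + 1)) := fun k hk =>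
    hφ.mono_set (by
      rw [uIcc_of_le (hmono 0 m (by omega) le_rfl), uIcc_of_le (hmono k (k + 1) (by omega) hk)]
      exact Icc_subset_Icc (hmono _ _ (by omega) hk.le) (hmono _ _ hk le_rfl))
  rw [← intervalIntegral.sum_integral_adjacent_intervals hint]
  exact Finset.sum_congr rfl fun i hi =>
    (hy i (Finset.mem_range.1 hi)).integral_eq (hint i (Finset.mem_range.1 hi))

/-! ### Analytic functions on a compact interval -/

/-- Outside [a, b] the values of f are arbitrary, so `deriv f` is meaningless at the endpoints. An
extension analytic on a neighbourhood is glued from the local extensions at a and at b, each of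
which agrees with f on all of [a, b]. -/
theorem exists_analyticOnNhd_eqOn {f : ℝ → ℝ} {a b : ℝ} (hab : a < b)
    (hf : AnalyticOn ℝ f (Icc a b)) :
    ∃ G : ℝ → ℝ, AnalyticOnNhd ℝ G (Icc a b) ∧ EqOn f G (Icc a b) := by
  classical
  have ha := left_mem_Icc.2 hab.le
  have hb := right_mem_Icc.2 hab.le
  obtain ⟨p, -, hp, hpa⟩ := (hf a ha).exists_analyticAt
  obtain ⟨q, -, hq, hqb⟩ := (hf b hb).exists_analyticAt
  rw [insert_eq_of_mem ha] at hp
  rw [insert_eq_of_mem hb] at hq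
  obtain ⟨e, hae, heb⟩ := exists_between hab
  have hEq : EqOn f ((Iio e).piecewise p q) (Icc a b) := by
    intro x hx
    by_cases hxe : x ∈ Iio e
    · rw [piecewise_eq_of_mem _ _ _ hxe]
      exact hp hx
    · rw [piecewise_eq_of_notMem _ _ _ hxe]
      exact hq hx
  refine ⟨(Iio e).piecewise p q, fun x hx => ?_, hEq⟩
  rcases hx.1.eq_or_lt with rfl | hax
  · refine hpa.congr ?_
    filter_upwards [Iio_mem_nhds hae] with y hy
    exact (piecewise_eq_of_mem _ _ _ hy).symm
  rcases hx.2.eq_or_lt with rfl | hxb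
  · refine hqb.congr ?_
    filter_upwards [Ioi_mem_nhds heb] with y hy
    exact (piecewise_eq_of_notMem _ _ _ (notMem_Iio.2 (mem_Ioi.1 hy).le)).symm
  · have hn := Icc_mem_nhds hax hxb
    exact (hf.analyticAt hn).congr (hEq.eventuallyEq_of_mem hn)

theorem analyticOrderAt_ne_top_of_exists_ne_zero {f : ℝ → ℝ} {a b : ℝ}
    (hf : AnalyticOnNhd ℝ f (Icc a b)) (hne : ∃ x ∈ Icc a b, f x ≠ 0) :
    ∀ x ∈ Icc a b, analyticOrderAt f x ≠ ⊤ := by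
  rintro x hx htop
  obtain ⟨y, hy, hy0⟩ := hne
  exact hy0 (hf.eqOn_zero_of_preconnected_of_eventuallyEq_zero isPreconnected_Icc hx
    (analyticOrderAt_eq_top.1 htop) hy)

theorem finite_zeros {f : ℝ → ℝ} {a b : ℝ} (hf : AnalyticOnNhd ℝ f (Icc a b))
    (hne : ∃ x ∈ Icc a b, f x ≠ 0) : {x | x ∈ Icc a b ∧ f x = 0}.Finite := by
  by_contra hinf
  obtain ⟨x, hx, hacc⟩ := Set.Infinite.exists_accPt_of_subset_isCompact hinf
    (isCompact_Icc (a := a) (b := b)) fun y hy => hy.1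
  rw [accPt_iff_frequently_nhdsNE] at hacc
  refine hacc ?_
  filter_upwards [eventually_ne_zero_of_analyticOrderAt (hf x hx)
    (analyticOrderAt_ne_top_of_exists_ne_zero hf hne x hx)] with y hy hyS
  exact hy hyS.2

/-- The limit defining a multiplicity only sees interior points, where f and its analytic extension
have the same derivatives. -/
theorem eventually_mem_Ioo_of_Icc_sdiff {a b x : ℝ} :
    ∀ᶠ y in 𝓝[Icc a b \ {x}] x, y ∈ Ioo a b := by
  have hne : ∀ c : ℝ, ∀ᶠ y in 𝓝[Icc a b \ {x}] x, y ≠ c := by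
    intro c
    rcases eq_or_ne c x with rfl | hc
    · filter_upwards [self_mem_nhdsWithin] with y hy using hy.2
    · exact (isOpen_ne.mem_nhds hc.symm : {y | y ≠ c} ∈ 𝓝 x) |> mem_nhdsWithin_of_mem_nhds
  filter_upwards [hne a, hne b, self_mem_nhdsWithin] with y h1 h2 h3
  exact ⟨lt_of_le_of_ne h3.1.1 h1.symm, lt_of_le_of_ne h3.1.2 h2⟩

theorem neBot_nhdsWithin_Icc_sdiff {a b x : ℝ} (hab : a < b) (hx : x ∈ Icc a b) :
    (𝓝[Icc a b \ {x}] x).NeBot := by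
  rcases hx.2.eq_or_lt with rfl | hxb
  · exact (right_nhdsWithin_Ioo_neBot hab).mono
      (nhdsWithin_mono _ fun y hy => ⟨⟨hy.1.le, hy.2.le⟩, hy.2.ne⟩)
  · exact (left_nhdsWithin_Ioo_neBot hxb).mono
      (nhdsWithin_mono _ fun y hy => ⟨⟨hx.1.trans hy.1.le, hy.2.le⟩, hy.1.ne'⟩)

/-! ### One-sided limits of the boundary term -/

/-- Under y ↦ -f(c - y) both f'² and f f'' are merely reflected, so g₂ is too, whereas f'/f also
changes sign. -/
theorem boundaryTerm_reflect (h : ℝ → ℝ) (σ : EReal) (f : ℝ → ℝ) (c x : ℝ) :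
    boundaryTerm h σ (fun y => -f (c - y)) (g₂ fun y => -f (c - y)) x =
      primitive h σ (-(deriv f (c - x) / f (c - x))) * g₂ f (c - x) := by
  have h1 : deriv (fun y => -f (c - y)) = fun y => deriv f (c - y) := by
    funext y
    rw [deriv.fun_neg, deriv_comp_const_sub, neg_neg]
  have h2 : deriv (fun y => deriv f (c - y)) x = -deriv (deriv f) (c - x) := deriv_comp_const_sub ..
  simp only [boundaryTerm, g₂, h1, h2, neg_sq, neg_mul_neg, div_neg]

/-- Data collected at every point of `[a, b]`: the multiplicities `μ`, and the one-sided limits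
`L` and `R` of the boundary term. -/
structure LocalData (h : ℝ → ℝ) (σ : EReal) (f : ℝ → ℝ) (l r : ℝ) (a b : ℝ) (μ : ℝ → ℕ+)
    (L R : ℝ → ℝ) : Prop where
  analyticOnNhd : AnalyticOnNhd ℝ f (Icc a b)
  order_ne_top : ∀ x ∈ Icc a b, analyticOrderAt f x ≠ ⊤
  multiplicity : ∀ x ∈ Icc a b, f x = 0 →
    Tendsto (fun x => deriv f x ^ 2 / (deriv f x ^ 2 - f x * deriv (deriv f) x)) (𝓝[≠] x) (𝓝 (μ x))
  tendsto_left : ∀ x ∈ Icc a b, Tendsto (boundaryTerm h σ f (g₂ f)) (𝓝[<] x) (𝓝 (L x))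
  tendsto_right : ∀ x ∈ Icc a b, Tendsto (boundaryTerm h σ f (g₂ f)) (𝓝[>] x) (𝓝 (R x))
  left_eq_right : ∀ x ∈ Icc a b, f x ≠ 0 → L x = R x
  right_sub_left : ∀ x ∈ Icc a b, f x = 0 → R x - L x = (r - l) * Real.exp (1 / (μ x : ℝ))
  tendsto_reflect_left : ∀ x ∈ Icc a b, f x = 0 →
    Tendsto (boundaryTerm h σ (fun y => -f (2 * x - y)) (g₂ fun y => -f (2 * x - y)))
      (𝓝[<] x) (𝓝 (L x))
  tendsto_reflect_right : ∀ x ∈ Icc a b, f x = 0 →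
    Tendsto (boundaryTerm h σ (fun y => -f (2 * x - y)) (g₂ fun y => -f (2 * x - y)))
      (𝓝[>] x) (𝓝 (R x))

theorem tendsto_two_mul_sub_left (x : ℝ) : Tendsto (fun y => 2 * x - y) (𝓝[<] x) (𝓝[>] x) := by
  refine tendsto_nhdsWithin_iff.2 ⟨?_, ?_⟩
  · have : ContinuousAt (fun y => 2 * x - y) x := by fun_prop
    have h1 := this.tendsto
    rw [show 2 * x - x = x by ring] at h1
    exact h1.mono_left nhdsWithin_le_nhds
  · filter_upwards [self_mem_nhdsWithin] with y hy
    rw [mem_Iio] at hy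
    rw [mem_Ioi]
    linarith

theorem tendsto_two_mul_sub_right (x : ℝ) : Tendsto (fun y => 2 * x - y) (𝓝[>] x) (𝓝[<] x) := by
  refine tendsto_nhdsWithin_iff.2 ⟨?_, ?_⟩
  · have : ContinuousAt (fun y => 2 * x - y) x := by fun_prop
    have h1 := this.tendsto
    rw [show 2 * x - x = x by ring] at h1
    exact h1.mono_left nhdsWithin_le_nhds
  · filter_upwards [self_mem_nhdsWithin] with y hy
    rw [mem_Ioi] at hy
    rw [mem_Iio]
    linarith

theorem exists_localData {h f : ℝ → ℝ} {σ : EReal} {l r a b : ℝ}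
    (hH : Continuous (primitive h σ)) (hl : Tendsto (primitive h σ) atBot (𝓝 l))
    (hr : Tendsto (primitive h σ) atTop (𝓝 r)) (hf : AnalyticOnNhd ℝ f (Icc a b))
    (hne : ∃ x ∈ Icc a b, f x ≠ 0) : ∃ μ L R, LocalData h σ f l r a b μ L R := by
  classical
  have htop := analyticOrderAt_ne_top_of_exists_ne_zero hf hne
  have H : ∀ x : ℝ, ∃ m : ℕ+, x ∈ Icc a b → f x = 0 →
      Tendsto (fun x => deriv f x / f x) (𝓝[>] x) atTop ∧
      Tendsto (fun x => deriv f x / f x) (𝓝[<] x) atBot ∧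
      Tendsto (fun x => deriv f x ^ 2 / (deriv f x ^ 2 - f x * deriv (deriv f) x))
        (𝓝[≠] x) (𝓝 m) ∧ Tendsto (g₂ f) (𝓝[≠] x) (𝓝 (Real.exp (1 / (m : ℝ)))) := by
    intro x
    by_cases hx : x ∈ Icc a b ∧ f x = 0
    · obtain ⟨m, h1, h2, h3, E, hE, hE0, hgE⟩ := exists_multiplicity (hf x hx.1) (htop x hx.1) hx.2
      exact ⟨m, fun _ _ => ⟨h1, h2, h3,
        (hE0 ▸ hE.continuousAt.tendsto.mono_left nhdsWithin_le_nhds).congr' hgE.symm⟩⟩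
    · exact ⟨1, fun h1 h2 => absurd ⟨h1, h2⟩ hx⟩
  choose μ hμ using H
  refine ⟨μ, fun x => if f x = 0 then l * Real.exp (1 / (μ x : ℝ)) else boundaryTerm h σ f (g₂ f) x,
    fun x => if f x = 0 then r * Real.exp (1 / (μ x : ℝ)) else boundaryTerm h σ f (g₂ f) x,
    hf, htop, fun x hx h0 => (hμ x hx h0).2.2.1, fun x hx => ?_, fun x hx => ?_, fun x hx h0 => ?_,
    fun x hx h0 => ?_, fun x hx h0 => ?_, fun x hx h0 => ?_⟩
  · by_cases h0 : f x = 0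
    · simp only [if_pos h0]
      obtain ⟨-, h2, -, h4⟩ := hμ x hx h0
      exact (hl.comp h2).mul (h4.mono_left (nhdsWithin_mono _ fun y hy => ne_of_lt hy))
    · simp only [if_neg h0]
      exact (continuousAt_boundaryTerm hH (hf x hx).contDiffAt h0).tendsto.mono_left
        nhdsWithin_le_nhds
  · by_cases h0 : f x = 0
    · simp only [if_pos h0]
      obtain ⟨h1, -, -, h4⟩ := hμ x hx h0
      exact (hr.comp h1).mul (h4.mono_left (nhdsWithin_mono _ fun y hy => ne_of_gt hy))
    · simp only [if_neg h0]
      exact (continuousAt_boundaryTerm hH (hf x hx).contDiffAt h0).tendsto.mono_left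
        nhdsWithin_le_nhds
  · simp only [if_neg h0]
  · simp only [if_pos h0]
    ring
  -- The reflection swaps the sides and the sign change swaps ±∞, so the left limit of H(f'/f) is
  -- again l.
  · simp only [if_pos h0, funext (boundaryTerm_reflect h σ f (2 * x))]
    obtain ⟨h1, -, -, h4⟩ := hμ x hx h0
    have ht := tendsto_two_mul_sub_left x
    exact (hl.comp (tendsto_neg_atTop_atBot.comp (h1.comp ht))).mul
      ((h4.mono_left (nhdsWithin_mono _ fun y hy => ne_of_gt hy)).comp ht)
  · simp only [if_pos h0, funext (boundaryTerm_reflect h σ f (2 * x))]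
    obtain ⟨-, h2, -, h4⟩ := hμ x hx h0
    have ht := tendsto_two_mul_sub_right x
    exact (hr.comp (tendsto_neg_atBot_atTop.comp (h2.comp ht))).mul
      ((h4.mono_left (nhdsWithin_mono _ fun y hy => ne_of_lt hy)).comp ht)

theorem EqOn.eventuallyEq_nhds_of_Ioo {f F : ℝ → ℝ} {a b x : ℝ} (hfF : EqOn f F (Icc a b))
    (hx : x ∈ Ioo a b) : f =ᶠ[𝓝 x] F :=
  hfF.eventuallyEq_of_mem (Icc_mem_nhds hx.1 hx.2)

theorem eventuallyEq_boundaryTerm_right {f F : ℝ → ℝ} {a b x : ℝ} (h : ℝ → ℝ) (σ : EReal)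
    (hfF : EqOn f F (Icc a b)) (hx : x ∈ Ico a b) :
    boundaryTerm h σ f (g₂ f) =ᶠ[𝓝[>] x] boundaryTerm h σ F (g₂ F) := by
  filter_upwards [Ioo_mem_nhdsGT hx.2] with y hy
  exact boundaryTerm_congr h σ (EqOn.eventuallyEq_nhds_of_Ioo hfF ⟨hx.1.trans_lt hy.1, hy.2⟩)

theorem eventuallyEq_boundaryTerm_left {f F : ℝ → ℝ} {a b x : ℝ} (h : ℝ → ℝ) (σ : EReal)
    (hfF : EqOn f F (Icc a b)) (hx : x ∈ Ioc a b) :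
    boundaryTerm h σ f (g₂ f) =ᶠ[𝓝[<] x] boundaryTerm h σ F (g₂ F) := by
  filter_upwards [Ioo_mem_nhdsLT hx.1] with y hy
  exact boundaryTerm_congr h σ (EqOn.eventuallyEq_nhds_of_Ioo hfF ⟨hy.1, hy.2.trans_le hx.2⟩)

theorem tendsto_boundaryTerm_extension_left {h f F G : ℝ → ℝ} {σ : EReal} {l r a b : ℝ}
    {μ : ℝ → ℕ+} {L R : ℝ → ℝ} (hab : a < b) (hH : Continuous (primitive h σ))
    (D : LocalData h σ G l r a b μ L R) (hfG : EqOn f G (Icc a b))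
    (hF : IsEndpointExtension f F a b) :
    Tendsto (boundaryTerm h σ F (g₂ F)) (𝓝[<] a) (𝓝 (L a)) := by
  have ha := left_mem_Icc.2 hab.le
  by_cases h0 : f a = 0
  · refine (D.tendsto_reflect_left a ha (hfG ha ▸ h0)).congr' ?_
    have h1 := eventually_eventually_nhdsWithin.2 (hF.left_antisymm h0)
    have h2 : ∀ᶠ x in 𝓝[<] a, x ∈ Ioo (2 * a - b) a := Ioo_mem_nhdsLT (by linarith)
    filter_upwards [h1, h2] with x hx hx2
    refine boundaryTerm_congr h σ ?_
    -- The boundary term involves derivatives, so agreement is needed on a full neighbourhood of x,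
    -- not only at x.
    rw [IsOpen.nhdsWithin_eq isOpen_Iio hx2.2] at hx
    filter_upwards [hx, Ioo_mem_nhds hx2.1 hx2.2] with y hy hy2
    rw [hy, hfG ⟨by linarith [hy2.2], by linarith [hy2.1]⟩]
  · have hFa : F a ≠ 0 := by rwa [hF.eqOn ha]
    have hc := (continuousAt_boundaryTerm hH (hF.left_regular h0) hFa).tendsto
    -- The value at a is identified through the limit from inside [a, b], so derivatives of F and G
    -- at a need not be compared.
    have h1 := (hc.mono_left nhdsWithin_le_nhds).congr' (eventuallyEq_boundaryTerm_right h σ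
      (hF.eqOn.trans hfG) (left_mem_Ico.2 hab))
    have h2 := tendsto_nhds_unique h1 (D.tendsto_right a ha)
    rw [D.left_eq_right a ha (hfG ha ▸ h0), ← h2]
    exact hc.mono_left nhdsWithin_le_nhds

theorem tendsto_boundaryTerm_extension_right {h f F G : ℝ → ℝ} {σ : EReal} {l r a b : ℝ}
    {μ : ℝ → ℕ+} {L R : ℝ → ℝ} (hab : a < b) (hH : Continuous (primitive h σ))
    (D : LocalData h σ G l r a b μ L R) (hfG : EqOn f G (Icc a b))
    (hF : IsEndpointExtension f F a b) :
    Tendsto (boundaryTerm h σ F (g₂ F)) (𝓝[>] b) (𝓝 (R b)) := by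
  have hb := right_mem_Icc.2 hab.le
  by_cases h0 : f b = 0
  · refine (D.tendsto_reflect_right b hb (hfG hb ▸ h0)).congr' ?_
    have h1 := eventually_eventually_nhdsWithin.2 (hF.right_antisymm h0)
    have h2 : ∀ᶠ x in 𝓝[>] b, x ∈ Ioo b (2 * b - a) := Ioo_mem_nhdsGT (by linarith)
    filter_upwards [h1, h2] with x hx hx2
    refine boundaryTerm_congr h σ ?_
    rw [IsOpen.nhdsWithin_eq isOpen_Ioi hx2.1] at hx
    filter_upwards [hx, Ioo_mem_nhds hx2.1 hx2.2] with y hy hy2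
    rw [hy, hfG ⟨by linarith [hy2.2], by linarith [hy2.1]⟩]
  · have hFb : F b ≠ 0 := by rwa [hF.eqOn hb]
    have hc := (continuousAt_boundaryTerm hH (hF.right_regular h0) hFb).tendsto
    have h1 := (hc.mono_left nhdsWithin_le_nhds).congr' (eventuallyEq_boundaryTerm_left h σ
      (hF.eqOn.trans hfG) (right_mem_Ioc.2 hab))
    have h2 := tendsto_nhds_unique h1 (D.tendsto_left b hb)
    rw [← D.left_eq_right b hb (hfG hb ▸ h0), ← h2]
    exact hc.mono_left nhdsWithin_le_nhds

theorem exists_isEndpointExtension {f G : ℝ → ℝ} {a b : ℝ} (hab : a < b)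
    (hG : AnalyticOnNhd ℝ G (Icc a b)) (hfG : EqOn f G (Icc a b)) :
    ∃ F, IsEndpointExtension f F a b := by
  classical
  refine ⟨fun x => if x < a then (if f a = 0 then -f (2 * a - x) else G x)
    else if x ≤ b then f x else (if f b = 0 then -f (2 * b - x) else G x), ?_, ?_, ?_, ?_, ?_⟩
  · intro x hx
    simp only [if_neg (not_lt.2 hx.1), if_pos hx.2]
  · intro h0
    refine (hG a (left_mem_Icc.2 hab.le)).contDiffAt.congr_of_eventuallyEq ?_
    filter_upwards [Iio_mem_nhds hab] with x hx
    rw [mem_Iio] at hx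
    by_cases hxa : x < a
    · simp only [if_pos hxa, if_neg h0]
    · simp only [if_neg hxa, if_pos hx.le]
      exact hfG ⟨not_lt.1 hxa, hx.le⟩
  · intro h0
    filter_upwards [self_mem_nhdsWithin] with x hx
    rw [mem_Iio] at hx
    simp only [if_pos hx, if_pos h0]
  · intro h0
    refine (hG b (right_mem_Icc.2 hab.le)).contDiffAt.congr_of_eventuallyEq ?_
    filter_upwards [Ioi_mem_nhds hab] with x hx
    rw [mem_Ioi] at hx
    by_cases hxb : x ≤ b
    · simp only [if_neg (not_lt.2 hx.le), if_pos hxb]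
      exact hfG ⟨hx.le, hxb⟩
    · simp only [if_neg (not_lt.2 hx.le), if_neg hxb, if_neg h0]
  · intro h0
    filter_upwards [self_mem_nhdsWithin] with x hx
    rw [mem_Ioi] at hx
    simp only [if_neg (not_lt.2 (hab.trans hx).le), if_neg (not_le.2 hx), if_pos h0]

/-! ### Counting -/

theorem profileMap_sum_single (Z : Finset ℝ) (μ : ℝ → ℕ+) :
    profileMap (∑ z ∈ Z, Finsupp.single (μ z) 1) = ∑ z ∈ Z, Real.exp (1 / (μ z : ℝ)) := by
  classical
  induction Z using Finset.induction_on with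
  | empty => simp [profileMap]
  | insert z Z hz ih =>
    rw [Finset.sum_insert hz, Finset.sum_insert hz, ← ih]
    unfold profileMap
    rw [Finsupp.sum_add_index' (by simp) (by intros; push_cast; ring)]
    simp

theorem encard_eq_sum_single {Z : Finset ℝ} {μ : ℝ → ℕ+} {ℓ : ℕ+} {S : Set ℝ}
    (hS : ∀ x, x ∈ S ↔ x ∈ Z ∧ μ x = ℓ) :
    S.encard = ((∑ z ∈ Z, Finsupp.single (μ z) 1 : ℕ+ →₀ ℕ) ℓ : ℕ∞) := by
  classical
  have h1 : S = (Z.filter fun x => μ x = ℓ : Finset ℝ) := by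
    ext x
    rw [hS, Finset.mem_coe, Finset.mem_filter]
  rw [h1, Set.encard_coe_eq_coe_finsetCard, Finsupp.finsetSum_apply, Finset.card_filter]
  simp only [Finsupp.single_apply]

theorem hasMultiplicity_iff {h f G : ℝ → ℝ} {σ : EReal} {l r a b x m : ℝ} {μ : ℝ → ℕ+}
    {L R : ℝ → ℝ} (hab : a < b) (D : LocalData h σ G l r a b μ L R) (hfG : EqOn f G (Icc a b))
    (hx : x ∈ Icc a b) (h0 : f x = 0) : HasMultiplicity f a b x m ↔ (μ x : ℝ) = m := by
  have := neBot_nhdsWithin_Icc_sdiff hab hx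
  have h1 : HasMultiplicity f a b x (μ x) := by
    refine ((D.multiplicity x hx (hfG hx ▸ h0)).mono_left
      (nhdsWithin_mono _ fun y hy => hy.2)).congr' ?_
    filter_upwards [eventually_mem_Ioo_of_Icc_sdiff] with y hy
    have h2 := EqOn.eventuallyEq_nhds_of_Ioo hfG hy
    rw [h2.eq_of_nhds, h2.deriv_eq, h2.deriv.deriv_eq]
  exact ⟨fun h2 => tendsto_nhds_unique h1 h2, fun h2 => h2 ▸ h1⟩

theorem intervalIntegrable_integrand {h f G : ℝ → ℝ} {σ : EReal} {l r a b : ℝ} {μ : ℝ → ℕ+}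
    {L R : ℝ → ℝ} (hab : a < b) (hh : PiecewiseContinuous h) (hH : Continuous (primitive h σ))
    (hl : Tendsto (primitive h σ) atBot (𝓝 l)) (hr : Tendsto (primitive h σ) atTop (𝓝 r))
    (hO : Asymptotics.IsBigO (cocompact ℝ) h (fun x : ℝ => 1 / x ^ 2))
    (D : LocalData h σ G l r a b μ L R) (hfG : EqOn f G (Icc a b)) :
    IntervalIntegrable (integrand h σ f (g₂ f)) volume a b := by
  refine intervalIntegrable_of_locally_bounded hab.le (aestronglyMeasurable_integrand
    (measurable_of_countable_not_continuousAt hh.countable) hH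
    ((D.analyticOnNhd.continuousOn.congr hfG).mono Ioo_subset_Icc_self)) fun x hx => ?_
  have hb : ∃ C, ∀ᶠ y in 𝓝[≠] x, |integrand h σ G (g₂ G) y| ≤ C := by
    by_cases h0 : G x = 0
    · exact exists_bound_integrand_of_zero hO hl hr (D.analyticOnNhd x hx) (D.order_ne_top x hx) h0
    · obtain ⟨C, hC⟩ := exists_bound_integrand_of_ne_zero hh hH (D.analyticOnNhd x hx) h0
      exact ⟨C, hC.filter_mono nhdsWithin_le_nhds⟩
  obtain ⟨C, hC⟩ := hb
  refine ⟨C, hC.mono fun y hy hyI => ?_⟩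
  rwa [integrand_congr h σ (EqOn.eventuallyEq_nhds_of_Ioo hfG hyI)]

end ZeroCount

end

/-! ### Assembly of the counting formula -/

theorem mainTheorem3 :
    Function.Injective ZeroCount.profileMap ∧
    ∀ (a b : ℝ) (f h : ℝ → ℝ) (σ : EReal), a < b →
      AnalyticOn ℝ f (Icc a b) → (∃ x ∈ Icc a b, f x ≠ 0) →
      ZeroCount.PiecewiseContinuous h → ZeroCount.HasImproperIntegralLine h 1 →
      ∃ n n' : ℕ+ →₀ ℕ,
        (∀ ℓ : ℕ+, (ZeroCount.zerosIcc f a b ℓ).encard = (n ℓ : ℕ∞)) ∧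
        (∀ ℓ : ℕ+, (ZeroCount.zerosIoo f a b ℓ).encard = (n' ℓ : ℕ∞)) ∧
        ∃ J : ℝ,
          ZeroCount.HasImproperIntegral
            (ZeroCount.integrand h σ f (ZeroCount.g₂ f)) a b J ∧
          (Asymptotics.IsBigO (cocompact ℝ) h (fun x : ℝ => 1 / x ^ 2) →
            IntervalIntegrable (ZeroCount.integrand h σ f (ZeroCount.g₂ f)) volume a b ∧
            ∫ x in a..b, ZeroCount.integrand h σ f (ZeroCount.g₂ f) x = J) ∧
          (∃ F : ℝ → ℝ, ZeroCount.IsEndpointExtension f F a b) ∧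
          (∀ F : ℝ → ℝ, ZeroCount.IsEndpointExtension f F a b →
            ∃ A B : ℝ,
              Tendsto (ZeroCount.boundaryTerm h σ F (ZeroCount.g₂ F)) (𝓝[<] a) (𝓝 A) ∧
              Tendsto (ZeroCount.boundaryTerm h σ F (ZeroCount.g₂ F)) (𝓝[>] b) (𝓝 B) ∧
              ZeroCount.profileMap n = J + B - A ∧
              n = Function.invFun ZeroCount.profileMap (J + B - A)) ∧
          (∃ A B : ℝ,
              Tendsto (ZeroCount.boundaryTerm h σ f (ZeroCount.g₂ f)) (𝓝[>] a) (𝓝 A) ∧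
              Tendsto (ZeroCount.boundaryTerm h σ f (ZeroCount.g₂ f)) (𝓝[<] b) (𝓝 B) ∧
              ZeroCount.profileMap n' = J + B - A ∧
              n' = Function.invFun ZeroCount.profileMap (J + B - A)) := by
  refine ⟨ZeroCount.profileMap_injective, fun a b f h σ hab hf hne hh hI => ?_⟩
  classical
  have hinv : ∀ (n : ℕ+ →₀ ℕ) (x : ℝ), ZeroCount.profileMap n = x →
      n = Function.invFun ZeroCount.profileMap x := by
    rintro n _ rfl
    exact (Function.leftInverse_invFun ZeroCount.profileMap_injective n).symm
  obtain ⟨G, hG, hfG⟩ := ZeroCount.exists_analyticOnNhd_eqOn hab hf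
  have hneG : ∃ x ∈ Icc a b, G x ≠ 0 := by
    obtain ⟨x, hx, hx0⟩ := hne
    exact ⟨x, hx, hfG hx ▸ hx0⟩
  have hH := ZeroCount.continuous_primitive hI σ
  obtain ⟨l, r, hl, hr, hrl⟩ := ZeroCount.exists_tendsto_primitive hI σ
  obtain ⟨μ, L, R, D⟩ := ZeroCount.exists_localData hH hl hr hG hneG
  set Z : Finset ℝ := (ZeroCount.finite_zeros hG hneG).toFinset with hZdef
  have hZ : ∀ x, x ∈ Z ↔ x ∈ Icc a b ∧ G x = 0 := fun x => by rw [hZdef, Finite.mem_toFinset]; rfl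
  have hsub : ∀ z ∈ Z, R z - L z = Real.exp (1 / (μ z : ℝ)) := by
    intro z hz
    rw [D.right_sub_left z ((hZ z).1 hz).1 ((hZ z).1 hz).2, hrl, one_mul]
  have ha := left_mem_Icc.2 hab.le
  have hb := right_mem_Icc.2 hab.le
  have himp : ZeroCount.HasImproperIntegral (ZeroCount.integrand h σ f (ZeroCount.g₂ f)) a b
      (R a - L b + ∑ z ∈ Z with a < z ∧ z < b, (R z - L z)) := by
    refine ZeroCount.hasImproperIntegral_of_finset Z hab fun c d hc hcd hd hcdZ => ?_
    have hIoo : Ioo c d ⊆ Icc a b := fun x hx => ⟨hc.trans hx.1.le, hx.2.le.trans hd⟩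
    refine ZeroCount.hasImproperIntegralIoo_integrand hh hI hcd (fun x hx => ?_) (fun x hx h0 => ?_)
      ?_ ?_
    · exact (hG x (hIoo hx)).congr (ZeroCount.EqOn.eventuallyEq_nhds_of_Ioo hfG
        ⟨hc.trans_lt hx.1, hx.2.trans_le hd⟩).symm
    · exact hcdZ x ((hZ x).2 ⟨hIoo hx, hfG (hIoo hx) ▸ h0⟩) hx
    · exact (D.tendsto_right c ⟨hc, hcd.le.trans hd⟩).congr'
        (ZeroCount.eventuallyEq_boundaryTerm_right h σ hfG ⟨hc, hcd.trans_le hd⟩).symm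
    · exact (D.tendsto_left d ⟨hc.trans hcd.le, hd⟩).congr'
        (ZeroCount.eventuallyEq_boundaryTerm_left h σ hfG ⟨hc.trans_lt hcd, hd⟩).symm
  have hinner : ∑ z ∈ Z with a < z ∧ z < b, (R z - L z) =
      ∑ z ∈ Z with a < z ∧ z < b, Real.exp (1 / (μ z : ℝ)) :=
    Finset.sum_congr rfl fun z hz => hsub z (Finset.mem_filter.1 hz).1
  have houter : (R a - L a) + (R b - L b) + ∑ z ∈ Z with a < z ∧ z < b, (R z - L z) =
      ∑ z ∈ Z, Real.exp (1 / (μ z : ℝ)) := by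
    -- Both endpoints are included whether or not they are zeros: at a non-zero endpoint the jump R
    -- - L is 0.
    have h1 : ∑ z ∈ insert a (insert b (Z.filter fun z => a < z ∧ z < b)), (R z - L z) =
        ∑ z ∈ Z, (R z - L z) := by
      symm
      refine Finset.sum_subset (fun z hz => ?_) fun z hz hzZ => ?_
      · have hzI := ((hZ z).1 hz).1
        rcases hzI.1.eq_or_lt with rfl | h1
        · simp
        · rcases hzI.2.eq_or_lt with rfl | h2
          · simp
          · simp [hz, h1, h2]
      · have hzI : z ∈ Icc a b := by
          simp only [Finset.mem_insert, Finset.mem_filter] at hz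
          rcases hz with rfl | rfl | ⟨-, h1, h2⟩
          · exact ha
          · exact hb
          · exact ⟨h1.le, h2.le⟩
        rw [D.left_eq_right z hzI fun h0 => hzZ ((hZ z).2 ⟨hzI, h0⟩), sub_self]
    rw [Finset.sum_insert (by simp [hab.ne]), Finset.sum_insert (by simp), ← add_assoc] at h1
    rw [h1]
    exact Finset.sum_congr rfl hsub
  refine ⟨∑ z ∈ Z, Finsupp.single (μ z) 1,
    ∑ z ∈ Z with a < z ∧ z < b, Finsupp.single (μ z) 1, fun ℓ => ?_, fun ℓ => ?_, _, himp,
    fun hO => ?_, ZeroCount.exists_isEndpointExtension hab hG hfG, fun F hF => ?_, ?_⟩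
  · refine ZeroCount.encard_eq_sum_single fun x => ?_
    rw [hZ]
    constructor
    · rintro ⟨hx, h0, hm⟩
      rw [ZeroCount.hasMultiplicity_iff hab D hfG hx h0] at hm
      exact ⟨⟨hx, hfG hx ▸ h0⟩, by exact_mod_cast hm⟩
    · rintro ⟨⟨hx, h0⟩, rfl⟩
      rw [← hfG hx] at h0
      exact ⟨hx, h0, (ZeroCount.hasMultiplicity_iff hab D hfG hx h0).2 rfl⟩
  · refine ZeroCount.encard_eq_sum_single fun x => ?_
    rw [Finset.mem_filter, hZ]
    constructor
    · rintro ⟨hxo, h0, hm⟩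
      have hx := Ioo_subset_Icc_self hxo
      rw [ZeroCount.hasMultiplicity_iff hab D hfG hx h0] at hm
      exact ⟨⟨⟨hx, hfG hx ▸ h0⟩, hxo⟩, by exact_mod_cast hm⟩
    · rintro ⟨⟨⟨hx, h0⟩, hxo⟩, rfl⟩
      rw [← hfG hx] at h0
      exact ⟨hxo, h0, (ZeroCount.hasMultiplicity_iff hab D hfG hx h0).2 rfl⟩
  · have hint := ZeroCount.intervalIntegrable_integrand hab hh hH hl hr hO D hfG
    exact ⟨hint, himp.integral_eq hint⟩
  · have hmap : ZeroCount.profileMap (∑ z ∈ Z, Finsupp.single (μ z) 1) =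
        R a - L b + ∑ z ∈ Z with a < z ∧ z < b, (R z - L z) + R b - L a := by
      rw [ZeroCount.profileMap_sum_single, ← houter]
      ring
    exact ⟨L a, R b, ZeroCount.tendsto_boundaryTerm_extension_left hab hH D hfG hF,
      ZeroCount.tendsto_boundaryTerm_extension_right hab hH D hfG hF, hmap, hinv _ _ hmap⟩
  · have hmap : ZeroCount.profileMap (∑ z ∈ Z with a < z ∧ z < b, Finsupp.single (μ z) 1) =
        R a - L b + ∑ z ∈ Z with a < z ∧ z < b, (R z - L z) + L b - R a := by
      rw [ZeroCount.profileMap_sum_single, hinner]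
      ring
    exact ⟨R a, L b,
      (D.tendsto_right a ha).congr'
        (ZeroCount.eventuallyEq_boundaryTerm_right h σ hfG (left_mem_Ico.2 hab)).symm,
      (D.tendsto_left b hb).congr'
        (ZeroCount.eventuallyEq_boundaryTerm_left h σ hfG (right_mem_Ioc.2 hab)).symm,
      hmap, hinv _ _ hmap⟩
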